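/- Let $\Lambda=\mathbb{Q}[p_1,p_2,\dots]$ be the algebra of symmetric functions over $\mathbb{Q}$, where $p_i=\sum_j x_j^i$ are the power sums, and let $s_\lambda=\sum_T x^T\in\Lambda$ (sum over all semistandard Young tableaux $T$ of shape $\lambda$) be the Schur function of the partition $\lambda$. Let $*$ be the Kronecker product on $\Lambda$, i.e. the bilinear product with $p_\lambda * p_\mu=\delta_{\lambda\mu}z_\lambda p_\lambda$, where $z_\lambda=\prod_i i^{m_i}m_i!$ if $\lambda$ has $m_i$ parts equal to $i$. For a partition $\theta=(\theta_1\ge\theta_2\ge\cdots)$ let $l(\theta)$ be the number of its parts and $d_\theta$ the number of its distinct parts (the number of different values among its parts). Let $n\ge 2$. Then $s_{(n-1,n-1,1)} * s_{(n,n-1)}=\sum_{\theta\vdash 2n-1} g^{\theta}_{(n-1,n-1,1),(n,n-1)}\,s_\theta$, where the coefficients, which are uniquely determined by this expansion, are $$g^{\theta}_{(n-1,n-1,1),(n,n-1)}=\begin{cases}1 & \text{if } l(\theta)=5 \text{ and } \theta_5=1,\\ d_\theta-1 & \text{if } l(\theta)\le 4,\\ 0 & \text{otherwise.}\end{cases}$$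 -/

import Mathlib

namespace KroneckerProduct

/-- The parts `λ₁ ≥ λ₂ ≥ ⋯` of a partition, listed in weakly decreasing order. -/
def sortedParts {N : ℕ} (p : N.Partition) : List ℕ :=
  p.parts.sort (· ≥ ·)

/-- The Young (Ferrers) diagram of a partition. -/
def diagram {N : ℕ} (p : N.Partition) : YoungDiagram :=
  YoungDiagram.ofRowLens (sortedParts p) (p.parts.pairwise_sort (· ≥ ·)).sortedGE

/-- The length `l(λ)`: the number of parts. -/
def length {N : ℕ} (p : N.Partition) : ℕ :=
  p.parts.card

/-- The `i`-th part `λ_i`, with `i` starting at `1`; it is `0` if `i > l(λ)`. -/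
def part {N : ℕ} (p : N.Partition) (i : ℕ) : ℕ :=
  (sortedParts p).getD (i - 1) 0

/-- The number `d_λ` of distinct parts. -/
def numDistinctParts {N : ℕ} (p : N.Partition) : ℕ :=
  p.parts.toFinset.card

/-- The exponent vector of the monomial `x^T = ∏ x_{T(i,j)}` of a semistandard tableau. The entries
of tableaux and the indices of the variables start at `0` instead of `1`. -/
noncomputable def content {Y : YoungDiagram} (T : SemistandardYoungTableau Y) : ℕ →₀ ℕ :=
  ∑ c ∈ Y.cells, Finsupp.single (T c.1 c.2) 1

/-- Only finitely many semistandard tableaux of a given shape have a given content, so that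
the cardinality in the definition of `schur` is a genuine one. -/
theorem finite_content_eq (Y : YoungDiagram) (m : ℕ →₀ ℕ) :
    Finite {T : SemistandardYoungTableau Y // content T = m} := by
  classical
  let f : {T : SemistandardYoungTableau Y // content T = m} → (Y.cells → m.support) :=
    fun T c => ⟨T.1 c.1.1 c.1.2, by
      rw [Finsupp.mem_support_iff, ← DFunLike.congr_fun T.2, content, Finsupp.finsetSum_apply]
      intro h
      have := (Finset.sum_eq_zero_iff.mp h) c.1 c.2
      simp at this⟩
  refine Finite.of_injective f fun S T h => Subtype.ext (SemistandardYoungTableau.ext fun i j => ?_)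
  by_cases hc : (i, j) ∈ Y
  · exact congrArg Subtype.val (congrFun h ⟨(i, j), hc⟩)
  · rw [S.1.zeros hc, T.1.zeros hc]

/-- The Schur function `s_λ = ∑_T x^T`, a formal power series in `x₀, x₁, …`: the coefficient of a
monomial is the number of semistandard tableaux `T` of shape `λ` with that monomial as `x^T`. -/
noncomputable def schur {N : ℕ} (p : N.Partition) : MvPowerSeries ℕ ℚ :=
  fun m => (Nat.card {T : SemistandardYoungTableau (diagram p) // content T = m} : ℚ)

/-- The algebra `Λ = ℚ[p₁, p₂, …]` of symmetric functions, freely generated by the power sums.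
The monomial with exponent vector `m` is `p_λ`, where `λ` has `m i` parts equal to `i`. -/
abbrev SymFun : Type :=
  MvPolynomial ℕ+ ℚ

open Classical in
/-- The power sum `p_i = ∑_j x_j ^ i` as a formal power series. -/
noncomputable def powerSum (i : ℕ+) : MvPowerSeries ℕ ℚ :=
  fun m => if ∃ j : ℕ, m = Finsupp.single j (i : ℕ) then 1 else 0

/-- The realization of symmetric functions as formal power series in `x₀, x₁, …`. -/
noncomputable def realize : SymFun →ₐ[ℚ] MvPowerSeries ℕ ℚ :=
  MvPolynomial.aeval powerSum

/-- The number `z_λ = ∏ i ^ (m i) * (m i)!`, where `λ` has `m i` parts equal to `i`. -/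
def zee (m : ℕ+ →₀ ℕ) : ℕ :=
  m.prod fun i k => (i : ℕ) ^ k * k.factorial

/-- `z_λ` is the number of permutations that commute with a given one of cycle type `λ`. -/
theorem zee_eq_card_centralizer {N : ℕ} (σ : Equiv.Perm (Fin N)) (m : ℕ+ →₀ ℕ)
    (hm : ∀ i : ℕ+, m i = σ.partition.parts.count (i : ℕ)) :
    zee m = Nat.card (Subgroup.centralizer {σ}) := by
  classical
  rw [Equiv.Perm.nat_card_centralizer]
  have h1 : (1 : ℕ) ∉ σ.cycleType := fun h =>
    absurd (Equiv.Perm.one_lt_of_mem_cycleType h) (lt_irrefl 1)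
  have hz : zee m = ∏ i ∈ σ.partition.parts.toFinset,
      i ^ σ.partition.parts.count i * (σ.partition.parts.count i).factorial := by
    rw [zee, Finsupp.prod]
    refine Finset.prod_bij (fun i _ => (i : ℕ)) ?_ ?_ ?_ ?_
    · intro i hi
      rw [Finsupp.mem_support_iff, hm] at hi
      simpa [Multiset.count_eq_zero] using hi
    · intro i _ j _ h
      exact PNat.eq h
    · intro b hb
      have hb' := Multiset.mem_toFinset.mp hb
      refine ⟨Nat.toPNat b (σ.partition.parts_pos hb'), ?_, rfl⟩
      rw [Finsupp.mem_support_iff, hm]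
      exact fun h => Multiset.count_eq_zero.mp h hb'
    · intro i _
      rw [hm]
  rw [hz, Finset.prod_mul_distrib, ← Finset.prod_multiset_count, Equiv.Perm.parts_partition,
    Equiv.Perm.sum_cycleType]
  generalize hr : Fintype.card (Fin N) - σ.support.card = r
  have hprod : (σ.cycleType + Multiset.replicate r 1).prod = σ.cycleType.prod := by simp
  rw [hprod]
  have hf : ∏ i ∈ (σ.cycleType + Multiset.replicate r 1).toFinset,
      ((σ.cycleType + Multiset.replicate r 1).count i).factorial =
      ∏ i ∈ insert 1 σ.cycleType.toFinset,
        ((σ.cycleType + Multiset.replicate r 1).count i).factorial := by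
    refine Finset.prod_subset ?_ ?_
    · intro i hi
      rcases Multiset.mem_add.mp (Multiset.mem_toFinset.mp hi) with h | h
      · exact Finset.mem_insert_of_mem (Multiset.mem_toFinset.mpr h)
      · rw [Multiset.eq_of_mem_replicate h]
        exact Finset.mem_insert_self _ _
    · intro i _ hi
      rw [Multiset.count_eq_zero.mpr fun h => hi (Multiset.mem_toFinset.mpr h), Nat.factorial_zero]
  rw [hf, Finset.prod_insert (by simpa using h1)]
  have hone : (σ.cycleType + Multiset.replicate r 1).count 1 = r := by
    rw [Multiset.count_add, Multiset.count_eq_zero.mpr h1, Multiset.count_replicate_self, zero_add]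
  have hrest : ∏ i ∈ σ.cycleType.toFinset,
      ((σ.cycleType + Multiset.replicate r 1).count i).factorial =
      ∏ i ∈ σ.cycleType.toFinset, (σ.cycleType.count i).factorial := by
    refine Finset.prod_congr rfl fun i hi => ?_
    have hi1 : i ≠ 1 := fun h => h1 (h ▸ Multiset.mem_toFinset.mp hi)
    rw [Multiset.count_add, Multiset.count_replicate, if_neg (Ne.symm hi1), add_zero]
  rw [hone, hrest]
  ring

/-- The Kronecker product on `Λ`: the bilinear map with `p_λ * p_μ = δ_{λμ} z_λ p_λ`. -/
noncomputable def kronecker : SymFun →ₗ[ℚ] SymFun →ₗ[ℚ] SymFun :=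
  (MvPolynomial.basisMonomials ℕ+ ℚ).constr ℚ fun l =>
    (MvPolynomial.basisMonomials ℕ+ ℚ).constr ℚ fun m =>
      if l = m then (zee l : ℚ) • MvPolynomial.monomial l (1 : ℚ) else 0

/-- `(p_λ / z_λ) * (p_μ / z_μ) = δ_{λμ} p_λ / z_λ`. -/
theorem kronecker_powerSum (l m : ℕ+ →₀ ℕ) :
    kronecker ((zee l : ℚ)⁻¹ • MvPolynomial.monomial l (1 : ℚ))
        ((zee m : ℚ)⁻¹ • MvPolynomial.monomial m (1 : ℚ)) =
      if l = m then (zee l : ℚ)⁻¹ • MvPolynomial.monomial l (1 : ℚ) else 0 := by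
  have hz : (zee l : ℚ) ≠ 0 := by
    rw [zee, Finsupp.prod, Nat.cast_ne_zero, Finset.prod_ne_zero_iff]
    exact fun i _ => mul_ne_zero (pow_ne_zero _ i.ne_zero) (Nat.factorial_ne_zero _)
  have hb : ∀ k : ℕ+ →₀ ℕ,
      MvPolynomial.monomial k (1 : ℚ) = MvPolynomial.basisMonomials ℕ+ ℚ k := fun k => by
    rw [MvPolynomial.coe_basisMonomials]
  rw [map_smul, map_smul, LinearMap.smul_apply, kronecker, hb l, hb m, Module.Basis.constr_basis,
    Module.Basis.constr_basis]
  split_ifs with h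
  · subst h
    rw [hb l, smul_smul (zee l : ℚ)⁻¹ (zee l : ℚ), inv_mul_cancel₀ hz, one_smul]
  · simp

/-- `g` is the family of Kronecker coefficients `g^θ_{μν}` of `μ` and `ν`:
the Schur functions `s_μ` and `s_ν` are symmetric functions `F` and `G`,
and `s_μ * s_ν = ∑_θ g^θ_{μν} s_θ`. -/
def IsKroneckerCoefficients {N : ℕ} (μ ν : N.Partition) (g : N.Partition → ℚ) : Prop :=
  ∃ F G : SymFun, realize F = schur μ ∧ realize G = schur ν ∧
    realize (kronecker F G) = ∑ θ : N.Partition, g θ • schur θ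

/-- The partition `(n - 1, n - 1, 1)` of `2n - 1`. -/
def shapeThree (n : ℕ) (hn : 2 ≤ n) : (2 * n - 1).Partition where
  parts := {n - 1, n - 1, 1}
  parts_pos := by
    intro i hi
    simp only [Multiset.insert_eq_cons, Multiset.mem_cons, Multiset.mem_singleton] at hi
    omega
  parts_sum := by
    simp only [Multiset.insert_eq_cons, Multiset.sum_cons, Multiset.sum_singleton]
    omega

/-- The partition `(n, n - 1)` of `2n - 1`. -/
def shapeTwo (n : ℕ) (hn : 2 ≤ n) : (2 * n - 1).Partition where
  parts := {n, n - 1}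
  parts_pos := by
    intro i hi
    simp only [Multiset.insert_eq_cons, Multiset.mem_cons, Multiset.mem_singleton] at hi
    omega
  parts_sum := by
    simp only [Multiset.insert_eq_cons, Multiset.sum_cons, Multiset.sum_singleton]
    omega

end KroneckerProduct

/-! Write `n = m + 1`. Pieri's rule gives `s_{(m,m,1)} = p₁ s_{(m,m)} - s_{(m+1,m)}`, and for the
Kronecker product multiplication by `p₁` on one factor becomes `p₁ · ∂/∂p₁`: `(p₁ F) * G = p₁ (F *
∂G/∂p₁)`. As `∂/∂p₁` takes `s_{(m+1,m)}` to `s_{(m,m)} + s_{(m+1,m-1)}`, the product is `p₁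
(s_{(m,m)} * (s_{(m,m)} + s_{(m+1,m-1)})) - s_{(m+1,m)} * s_{(m+1,m)}`.

Both inner products are multiplicity free: each is the sum of all `s_t` with `t` a partition of the
right size into at most four parts (`kronecker_even`, `kronecker_odd`). Multiplying the first by
`p₁` yields each `s_θ` with `l(θ) ≤ 4` once per removable corner, i.e. `d_θ` times, and each `s_θ`
with `l(θ) = 5`, `θ₅ = 1` once (`pw_zero_mul_sum_jtQuad`). Subtracting the second leaves the stated
coefficients (`kronecker_jt`).

The multiplicity-free formulas come from comparing two expansions in products of four `h`'s. On one
side, `(h_c h_d) * (h_a h_b)` is a sum over nonnegative `2 × 2` matrices with these margins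
(`kronecker_hn_mul_hn`). On the other, the sum of all four-row Jacobi–Trudi determinants is a sum of
maximal minors of a matrix with four columns, hence a Pfaffian (`sum_detFour`), whose entries reduce
to the sums `D_e = ∑_{x-y=e} h_x h_y`; it equals `(D₀ + D₁)(D₀ + D₃) - (D₁ + D₂)²`. A parity
condition on the degree selects the terms of each case.

Since `schur` is defined by tableaux, the Jacobi–Trudi formula is also needed: determinants and
tableau counts obey the same branching rule on splitting off one variable (`addVar_jt`,
`card_tableaux_add_single`). Finally, `realize_injective` makes the product independent of the
chosen preimages of the Schur functions, and `linearIndependent_schur` gives uniqueness of the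
coefficients. -/

namespace KroneckerProduct

open MvPolynomial (X C pderiv)
open Finset.HasAntidiagonal (antidiagonal)

/-! ### Complete homogeneous symmetric functions -/

/-- The power sum `p_{i+1}` as an element of `Λ`. -/
noncomputable def pw (i : ℕ) : SymFun := X i.succPNat

/-- The complete homogeneous symmetric functions, defined by Newton's identities
`r h_r = ∑ p_i h_{r-i}`. -/
noncomputable def hn : ℕ → SymFun
  | 0 => 1
  | r + 1 => C ((r + 1 : ℚ)⁻¹) * ∑ i : Fin (r + 1), pw i * hn (r - i)

theorem hn_zero : hn 0 = 1 := by rw [hn]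

theorem newton (r : ℕ) :
    ((r : SymFun) + 1) * hn (r + 1) = ∑ i ∈ Finset.range (r + 1), pw i * hn (r - i) := by
  rw [hn, Finset.sum_range, ← mul_assoc]
  have : ((r : SymFun) + 1) = C (r + 1 : ℚ) := by simp
  rw [this, ← map_mul, mul_inv_cancel₀ (by positivity), map_one, one_mul]

/-- The generating series of the complete homogeneous symmetric functions. -/
noncomputable def hSeries : PowerSeries SymFun := PowerSeries.mk hn

/-- Newton's identities in the form `H' = P H` with `P = ∑ p_{i+1} t^i`. Together with `H(0) = 1`
this determines `H`, so the effect on `H` of a substitution in the power sums can be read off from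
logarithmic derivatives. -/
theorem derivative_hSeries :
    PowerSeries.derivative SymFun hSeries = PowerSeries.mk pw * hSeries := by
  ext1 r
  rw [PowerSeries.coeff_derivative, PowerSeries.coeff_mul,
    Finset.Nat.sum_antidiagonal_eq_sum_range_succ_mk]
  simp only [hSeries, PowerSeries.coeff_mk]
  rw [mul_comm, newton]

/-- A power series over a `ℚ`-algebra is determined by its logarithmic derivative and its constant
coefficient. -/
theorem eq_of_derivative_eq_mul {R : Type*} [CommRing R] [Algebra ℚ R] {q A B : PowerSeries R}
    (h0 : PowerSeries.coeff 0 A = PowerSeries.coeff 0 B)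
    (hA : PowerSeries.derivative R A = q * A) (hB : PowerSeries.derivative R B = q * B) :
    A = B := by
  ext1 r
  induction r using Nat.strong_induction_on with
  | _ r ih =>
    cases r with
    | zero => exact h0
    | succ r =>
      have h1 := congrArg (PowerSeries.coeff r) hA
      have h2 := congrArg (PowerSeries.coeff r) hB
      rw [PowerSeries.coeff_derivative, PowerSeries.coeff_mul] at h1 h2
      have h3 : ∑ p ∈ antidiagonal r, PowerSeries.coeff p.1 q * PowerSeries.coeff p.2 A =
          ∑ p ∈ antidiagonal r, PowerSeries.coeff p.1 q * PowerSeries.coeff p.2 B := by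
        refine Finset.sum_congr rfl fun p hp => ?_
        rw [ih p.2 (by have := Finset.HasAntidiagonal.mem_antidiagonal.mp hp; omega)]
      have hu : IsUnit ((r : R) + 1) := by
        have : ((r : R) + 1) = algebraMap ℚ R (r + 1 : ℚ) := by simp
        rw [this]
        exact (IsUnit.mk0 (r + 1 : ℚ) (by positivity)).map _
      exact hu.mul_right_cancel (by rw [h1, h2, h3])

theorem derivative_map {R S : Type*} [CommRing R] [CommRing S] (f : R →+* S) (A : PowerSeries R) :
    PowerSeries.derivative S (PowerSeries.map f A) =
      PowerSeries.map f (PowerSeries.derivative R A) := by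
  ext1 r
  simp [PowerSeries.coeff_derivative]

theorem derivative_rescale {R : Type*} [CommRing R] (a : R) (A : PowerSeries R) :
    PowerSeries.derivative R (PowerSeries.rescale a A) =
      PowerSeries.C a * PowerSeries.rescale a (PowerSeries.derivative R A) := by
  ext1 r
  simp [PowerSeries.coeff_derivative, PowerSeries.coeff_rescale, pow_succ]
  ring

/-- The substitution `p_i ↦ p_i (x^i + y^i)` turns `P` into the sum of the logarithmic derivatives
of `H(xt)` and `H(yt)`, so it sends `H(t)` to `H(xt) H(yt)`. -/
theorem map_hn_of_scale {R : Type*} [CommRing R] [Algebra ℚ R] (f g : SymFun →+* R) (x y : R)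
    (h : ∀ i, f (pw i) = g (pw i) * (x ^ (i + 1) + y ^ (i + 1))) (c : ℕ) :
    f (hn c) = ∑ p ∈ antidiagonal c, x ^ p.1 * g (hn p.1) * (y ^ p.2 * g (hn p.2)) := by
  have key : PowerSeries.map f hSeries =
      PowerSeries.rescale x (PowerSeries.map g hSeries) *
        PowerSeries.rescale y (PowerSeries.map g hSeries) := by
    refine eq_of_derivative_eq_mul (q := PowerSeries.map f (PowerSeries.mk pw)) ?_ ?_ ?_
    · rw [PowerSeries.coeff_mul]
      simp [hSeries, hn_zero]
    · rw [derivative_map, derivative_hSeries, map_mul]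
    · have hq : PowerSeries.map f (PowerSeries.mk pw) =
          PowerSeries.C x * PowerSeries.rescale x (PowerSeries.map g (PowerSeries.mk pw)) +
          PowerSeries.C y * PowerSeries.rescale y (PowerSeries.map g (PowerSeries.mk pw)) := by
        ext1 r
        simp only [PowerSeries.coeff_map, PowerSeries.coeff_mk, h,
          map_add, PowerSeries.coeff_C_mul, PowerSeries.coeff_rescale]
        ring
      rw [Derivation.leibniz, smul_eq_mul, smul_eq_mul, derivative_rescale, derivative_rescale,
        derivative_map, derivative_hSeries, hq]
      simp only [map_mul]
      ring
  have h := congrArg (PowerSeries.coeff c) key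
  rw [PowerSeries.coeff_mul] at h
  simpa only [hSeries, PowerSeries.coeff_map, PowerSeries.coeff_mk,
    PowerSeries.coeff_rescale] using h

/-- Adding a variable `x` to the alphabet multiplies `H(t)` by `1 / (1 - xt)`, whose logarithmic
derivative is `∑ x^{i+1} t^i`. -/
theorem map_hn_of_add {R : Type*} [CommRing R] [Algebra ℚ R] (f g : SymFun →+* R) (x : R)
    (h : ∀ i, f (pw i) = g (pw i) + x ^ (i + 1)) (r : ℕ) :
    f (hn r) = ∑ p ∈ antidiagonal r, g (hn p.1) * x ^ p.2 := by
  have key : PowerSeries.map f hSeries =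
      PowerSeries.map g hSeries * PowerSeries.rescale x (PowerSeries.mk fun _ => 1) := by
    refine eq_of_derivative_eq_mul (q := PowerSeries.map f (PowerSeries.mk pw)) ?_ ?_ ?_
    · rw [PowerSeries.coeff_mul]
      simp [hSeries, hn_zero]
    · rw [derivative_map, derivative_hSeries, map_mul]
    · have hq : PowerSeries.map f (PowerSeries.mk pw) =
          PowerSeries.map g (PowerSeries.mk pw) +
          PowerSeries.C x * PowerSeries.rescale x (PowerSeries.mk fun _ => 1) := by
        ext1 r
        simp only [PowerSeries.coeff_map, PowerSeries.coeff_mk, h,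
          map_add, PowerSeries.coeff_C_mul, PowerSeries.coeff_rescale]
        ring
      have hg : PowerSeries.derivative R (PowerSeries.mk fun _ => 1) =
          (PowerSeries.mk fun _ => 1) * (PowerSeries.mk fun _ => 1) := by
        ext1 r
        rw [PowerSeries.coeff_derivative, PowerSeries.coeff_mul]
        simp
      rw [Derivation.leibniz, smul_eq_mul, smul_eq_mul, derivative_rescale,
        derivative_map, derivative_hSeries, hq, hg]
      simp only [map_mul]
      ring
  have h := congrArg (PowerSeries.coeff r) key
  rw [PowerSeries.coeff_mul] at h
  simpa only [hSeries, PowerSeries.coeff_map, PowerSeries.coeff_mk,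
    PowerSeries.coeff_rescale, mul_one] using h

/-- The complete homogeneous symmetric functions indexed by integers, zero at negative indices. -/
noncomputable def hz : ℤ → SymFun
  | Int.ofNat r => hn r
  | Int.negSucc _ => 0

@[simp] theorem hz_natCast (r : ℕ) : hz r = hn r := rfl

theorem hz_of_neg {r : ℤ} (h : r < 0) : hz r = 0 := by
  obtain ⟨k, rfl⟩ := Int.eq_negSucc_of_lt_zero h
  rfl

@[simp] theorem hz_zero : hz 0 = 1 := hn_zero

theorem hn_one : hn 1 = pw 0 := by
  have := newton 0
  simpa [hn_zero] using this

/-- The range may be any `L ≥ s` because the extra terms have `h` at a negative index. This freedom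
is what lets the sums in `pderiv_hn` be recombined without matching their lengths. -/
theorem newton_int (L : ℕ) (s : ℤ) (h : s ≤ L) :
    (s : SymFun) * hz s = ∑ i ∈ Finset.range L, pw i * hz (s - 1 - i) := by
  rcases lt_or_ge s 1 with hs | hs
  · rw [Finset.sum_eq_zero fun i _ => by rw [hz_of_neg (by omega), mul_zero]]
    rcases eq_or_lt_of_le (show s ≤ 0 by omega) with rfl | h'
    · simp
    · rw [hz_of_neg h', mul_zero]
  · obtain ⟨r, rfl⟩ : ∃ r : ℕ, s = (r : ℤ) + 1 := ⟨(s - 1).toNat, by omega⟩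
    have h1 : hz ((r : ℤ) + 1) = hn (r + 1) := rfl
    rw [h1]
    push_cast
    rw [newton]
    refine Eq.trans ?_ (Finset.sum_subset (s₁ := Finset.range (r + 1))
      (Finset.range_mono (by omega)) ?_)
    · refine Finset.sum_congr rfl fun i hi => ?_
      have : (r : ℤ) + 1 - 1 - i = ((r - i : ℕ) : ℤ) := by
        have := Finset.mem_range.mp hi
        omega
      rw [this, hz_natCast]
    · intro i _ hi
      rw [Finset.mem_range] at hi
      rw [hz_of_neg (by omega), mul_zero]

/-- Formally `H = exp(∑ p_k t^k / k)`, so `k ∂/∂p_k` multiplies `H` by `t^k`. The proof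
differentiates Newton's identities instead. -/
theorem pderiv_hn (i r : ℕ) :
    ((i : SymFun) + 1) * pderiv i.succPNat (hn r) = hz (r - (i + 1)) := by
  induction r using Nat.strong_induction_on with
  | _ r ih =>
    cases r with
    | zero => rw [hz_of_neg (by simp; omega), hn_zero]; simp
    | succ r =>
      have hr : ((r : SymFun) + 1) ≠ 0 := by exact_mod_cast Nat.succ_ne_zero r
      refine mul_left_cancel₀ hr ?_
      have h1 := congrArg (pderiv i.succPNat) (newton r)
      rw [map_sum] at h1
      have hc : ((r : SymFun) + 1) = C (r + 1 : ℚ) := by simp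
      rw [hc, MvPolynomial.pderiv_C_mul, ← hc] at h1
      rw [mul_left_comm, h1, Finset.mul_sum]
      -- Differentiating the factor `p_{i+1}` contributes `(i + 1) h_{r-i}`; the other terms
      -- recombine by `newton_int` to `(r - i) h_{r-i}`. Together they give `(r + 1) h_{r-i}`.
      have h2 : ∀ j ∈ Finset.range (r + 1),
          ((i : SymFun) + 1) * pderiv i.succPNat (pw j * hn (r - j)) =
          (if j = i then ((i : SymFun) + 1) * hz (r - j) else 0) +
            pw j * hz (((r : ℤ) + 1 - (i + 1)) - 1 - j) := by
        intro j hj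
        have hj' := Finset.mem_range.mp hj
        rw [Derivation.leibniz, smul_eq_mul, smul_eq_mul, mul_add, add_comm, mul_left_comm _ (pw j),
          ih _ (by omega)]
        have e1 : ((r - j : ℕ) : ℤ) = (r : ℤ) - j := by omega
        congr 1
        · rw [pw, MvPolynomial.pderiv_X]
          split_ifs with h
          · subst h; simp [← e1]
          · rw [Pi.single_eq_of_ne]
            · simp
            · intro h'
              exact h (by simpa using congrArg PNat.natPred h')
        · rw [e1]; congr 2; ring
      rw [Finset.sum_congr rfl h2, Finset.sum_add_distrib, Finset.sum_ite_eq',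
        ← newton_int _ _ (by push_cast; omega)]
      have e2 : ((r + 1 : ℕ) : ℤ) - (i + 1) = r - i := by push_cast; ring
      have e3 : (r : ℤ) + 1 - (i + 1) = r - i := by ring
      rw [e2, e3]
      split_ifs with h
      · push_cast; ring
      · rw [hz_of_neg (by simp at h; omega)]; simp

theorem pderiv_hz (i : ℕ) (r : ℤ) :
    ((i : SymFun) + 1) * pderiv i.succPNat (hz r) = hz (r - (i + 1)) := by
  rcases lt_or_ge r 0 with h | h
  · rw [hz_of_neg h, hz_of_neg (by omega)]; simp
  · lift r to ℕ using h
    exact pderiv_hn i r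

/-! ### The Kronecker product and multiplication by power sums -/

theorem kronecker_monomial (l m : ℕ+ →₀ ℕ) :
    kronecker (MvPolynomial.monomial l 1) (MvPolynomial.monomial m 1) =
      if l = m then (zee l : ℚ) • MvPolynomial.monomial l (1 : ℚ) else 0 := by
  have hb : ∀ k : ℕ+ →₀ ℕ,
      MvPolynomial.monomial k (1 : ℚ) = MvPolynomial.basisMonomials ℕ+ ℚ k := fun k => by
    rw [MvPolynomial.coe_basisMonomials]
  rw [kronecker, hb l, hb m, Module.Basis.constr_basis, Module.Basis.constr_basis, hb l]

theorem zee_ne_zero (l : ℕ+ →₀ ℕ) : (zee l : ℚ) ≠ 0 := by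
  rw [zee, Finsupp.prod, Nat.cast_ne_zero, Finset.prod_ne_zero_iff]
  exact fun i _ => mul_ne_zero (pow_ne_zero _ i.ne_zero) (Nat.factorial_ne_zero _)

theorem zee_add_single (l : ℕ+ →₀ ℕ) (i : ℕ+) :
    zee (l + Finsupp.single i 1) = i * (l i + 1) * zee l := by
  classical
  have h : ∀ m : ℕ+ →₀ ℕ, m.support ⊆ insert i l.support →
      zee m = ∏ j ∈ insert i l.support, (j : ℕ) ^ m j * (m j).factorial := fun m hm =>
    Finsupp.prod_of_support_subset _ hm _ (by simp)
  rw [h l (Finset.subset_insert _ _), h (l + Finsupp.single i 1),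
    ← Finset.mul_prod_erase _ _ (Finset.mem_insert_self i l.support),
    ← Finset.mul_prod_erase _ _ (Finset.mem_insert_self i l.support)]
  · have : ∀ j ∈ (insert i l.support).erase i,
        (j : ℕ) ^ (l + Finsupp.single i 1 : ℕ+ →₀ ℕ) j *
          ((l + Finsupp.single i 1 : ℕ+ →₀ ℕ) j).factorial =
        (j : ℕ) ^ l j * (l j).factorial := fun j hj => by
      rw [Finsupp.add_apply, Finsupp.single_eq_of_ne (Finset.ne_of_mem_erase hj), add_zero]
    rw [Finset.prod_congr rfl this, Finsupp.add_apply, Finsupp.single_eq_same, pow_succ,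
      Nat.factorial_succ]
    ring
  · intro j hj
    simp only [Finsupp.mem_support_iff, Finsupp.add_apply, Finset.mem_insert] at hj ⊢
    by_contra! h
    rw [Finsupp.single_eq_of_ne h.1, h.2] at hj
    exact hj rfl

/-- Multiplication by `p_i` is adjoint to `i ∂/∂p_i` for the Kronecker product. -/
theorem kronecker_X_mul (i : ℕ+) (F G : SymFun) :
    kronecker (X i * F) G = ((i : ℕ) : SymFun) * X i * kronecker F (pderiv i G) := by
  classical
  induction F using MvPolynomial.induction_on' with
  | add p q hp hq => rw [mul_add, map_add, map_add, LinearMap.add_apply, LinearMap.add_apply,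
      hp, hq, mul_add]
  | monomial l a =>
    induction G using MvPolynomial.induction_on' with
    | add p q hp hq => rw [map_add, hp, hq, map_add, map_add, mul_add]
    | monomial m b =>
      have ha : MvPolynomial.monomial l a = a • MvPolynomial.monomial l (1 : ℚ) := by
        rw [MvPolynomial.smul_monomial]; simp
      have hb : MvPolynomial.monomial m b = b • MvPolynomial.monomial m (1 : ℚ) := by
        rw [MvPolynomial.smul_monomial]; simp
      rw [ha, hb]
      simp only [mul_smul_comm, map_smul, LinearMap.smul_apply, Derivation.map_smul]
      congr 2
      rw [show (X i : SymFun) = MvPolynomial.monomial (Finsupp.single i 1) 1 from rfl,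
        MvPolynomial.monomial_mul, one_mul, kronecker_monomial,
        MvPolynomial.pderiv_monomial, one_mul]
      have hm : MvPolynomial.monomial (m - Finsupp.single i 1) (m i : ℚ) =
          (m i : ℚ) • MvPolynomial.monomial (m - Finsupp.single i 1) (1 : ℚ) := by
        rw [MvPolynomial.smul_monomial]; simp
      rw [hm, map_smul, kronecker_monomial]
      by_cases h0 : m i = 0
      · rw [h0, if_neg]
        · simp
        · rintro rfl
          simp at h0
      · have h1 : m - Finsupp.single i 1 + Finsupp.single i 1 = m :=
          tsub_add_cancel_of_le (by simpa using Nat.one_le_iff_ne_zero.mpr h0)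
        by_cases h : l = m - Finsupp.single i 1
        · have h2 : m i = l i + 1 := by
            rw [← h1, ← h]; simp
          rw [if_pos (by rw [h, add_comm, h1]), if_pos h, h2, add_comm, zee_add_single, add_comm]
          rw [MvPolynomial.smul_eq_C_mul, MvPolynomial.smul_eq_C_mul, MvPolynomial.smul_eq_C_mul,
            show MvPolynomial.monomial (l + Finsupp.single i 1) (1 : ℚ) =
              MvPolynomial.monomial l 1 * MvPolynomial.monomial (Finsupp.single i 1) 1 by
                rw [MvPolynomial.monomial_mul, one_mul]]
          push_cast
          simp only [map_mul, map_add, map_natCast, map_one]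
          ring
        · rw [if_neg h, if_neg]
          · simp
          · rintro rfl
            simp at h

theorem kronecker_pw_mul (i : ℕ) (F G : SymFun) :
    kronecker (pw i * F) G =
      pw i * kronecker F (((i : SymFun) + 1) * pderiv i.succPNat G) := by
  have h : ((i : SymFun) + 1) * pderiv i.succPNat G = (i + 1 : ℚ) • pderiv i.succPNat G := by
    rw [MvPolynomial.smul_eq_C_mul]; simp
  rw [h, map_smul, MvPolynomial.smul_eq_C_mul, pw, kronecker_X_mul]
  simp only [Nat.succPNat_coe, map_add, map_natCast, map_one]
  push_cast
  ring

theorem kronecker_one_left (G : SymFun) : kronecker 1 G = C (MvPolynomial.coeff 0 G) := by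
  classical
  induction G using MvPolynomial.induction_on' with
  | add p q hp hq => rw [map_add, hp, hq, MvPolynomial.coeff_add, map_add]
  | monomial m b =>
    have hb : MvPolynomial.monomial m b = b • MvPolynomial.monomial m (1 : ℚ) := by
      rw [MvPolynomial.smul_monomial]; simp
    rw [hb, map_smul, show (1 : SymFun) = MvPolynomial.monomial 0 1 from rfl, kronecker_monomial,
      MvPolynomial.coeff_smul, MvPolynomial.coeff_monomial]
    by_cases h : m = 0
    · subst h
      simp [zee, MvPolynomial.smul_eq_C_mul]
    · rw [if_neg h, if_neg (Ne.symm h)]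
      simp

theorem coeff_zero_hn (r : ℕ) : MvPolynomial.coeff 0 (hn r) = if r = 0 then 1 else 0 := by
  cases r with
  | zero => simp [hn_zero]
  | succ r =>
    rw [hn]
    simp only [← MvPolynomial.constantCoeff_eq, map_mul, map_sum, Nat.succ_ne_zero, if_false]
    simp [pw]

theorem coeff_zero_hz (r : ℤ) : MvPolynomial.coeff 0 (hz r) = if r = 0 then 1 else 0 := by
  rcases lt_or_ge r 0 with h | h
  · rw [hz_of_neg h, if_neg h.ne]; simp
  · lift r to ℕ using h
    rw [hz_natCast, coeff_zero_hn]; simp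

/-- Induction on symmetric functions: constants, sums, and multiplication by a power sum. -/
theorem symFun_induction {P : SymFun → Prop} (F : SymFun) (hC : ∀ a, P (C a))
    (hadd : ∀ F G, P F → P G → P (F + G)) (hmul : ∀ i F, P F → P (pw i * F)) : P F := by
  induction F using MvPolynomial.induction_on with
  | C a => exact hC a
  | add p q hp hq => exact hadd p q hp hq
  | mul_X p n hp =>
    have := hmul n.natPred p hp
    rwa [pw, PNat.succPNat_natPred, mul_comm] at this

/-! ### Kronecker product with products of two complete homogeneous functions -/

/-- The substitution `p_i ↦ p_i (x ^ i + y ^ i)`, with `x = C X` and `y = X`. -/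
noncomputable def scaleTwo : SymFun →ₐ[ℚ] Polynomial (Polynomial SymFun) :=
  MvPolynomial.aeval fun i : ℕ+ => Polynomial.C (Polynomial.C (X i)) *
    (Polynomial.C (Polynomial.X ^ (i : ℕ)) + Polynomial.X ^ (i : ℕ))

theorem scaleTwo_pw (i : ℕ) : scaleTwo (pw i) = Polynomial.C (Polynomial.C (pw i)) *
    (Polynomial.C (Polynomial.X ^ (i + 1)) + Polynomial.X ^ (i + 1)) := by
  rw [scaleTwo, pw, MvPolynomial.aeval_X]; rfl

/-- By the Leibniz rule, multiplying `F` by `p_{i+1}` lowers `a` or `b` by `i + 1` on the left. This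
is exactly what the factor `x^{i+1} + y^{i+1}` does to the coefficient of `x^a y^b` on the right. -/
theorem kronecker_hz_mul_hz (F : SymFun) (a b : ℤ) :
    kronecker F (hz a * hz b) =
      if 0 ≤ a ∧ 0 ≤ b then ((scaleTwo F).coeff b.toNat).coeff a.toNat else 0 := by
  induction F using symFun_induction generalizing a b with
  | hC c =>
    have : (C c : SymFun) = c • 1 := by rw [MvPolynomial.smul_eq_C_mul, mul_one]
    rw [this, map_smul, LinearMap.smul_apply, kronecker_one_left, map_smul, map_one,
      ← MvPolynomial.constantCoeff_eq, map_mul, MvPolynomial.constantCoeff_eq,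
      coeff_zero_hz, coeff_zero_hz]
    simp only [Polynomial.coeff_smul, Polynomial.coeff_one]
    by_cases ha : a = 0 <;> by_cases hb : b = 0
    · subst ha hb; simp
    · subst ha
      split_ifs <;> first | omega | simp
    · subst hb
      split_ifs <;> first | omega | simp_all [Polynomial.coeff_one]
      omega
    · split_ifs <;> first | omega | simp
  | hadd F G hF hG =>
    rw [map_add, LinearMap.add_apply, hF, hG, map_add]
    split_ifs <;> simp
  | hmul i F hF =>
    have hd : ((i : SymFun) + 1) * pderiv i.succPNat (hz a * hz b) =
        hz (a - (i + 1)) * hz b + hz a * hz (b - (i + 1)) := by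
      rw [Derivation.leibniz, smul_eq_mul, smul_eq_mul, ← pderiv_hz, ← pderiv_hz]
      ring
    rw [kronecker_pw_mul, hd, map_add, hF, hF, map_mul, scaleTwo_pw, mul_assoc, add_mul]
    simp only [Polynomial.coeff_C_mul, Polynomial.coeff_add, Polynomial.coeff_X_pow_mul']
    by_cases ha : 0 ≤ a
    · by_cases hb : 0 ≤ b
      · lift a to ℕ using ha
        lift b to ℕ using hb
        have e1 : ((a : ℤ) - (i + 1)).toNat = a - (i + 1) := by omega
        have e2 : ((b : ℤ) - (i + 1)).toNat = b - (i + 1) := by omega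
        rw [e1, e2]
        congr 1
        have e3 : (0 ≤ (a : ℤ) - (i + 1) ∧ 0 ≤ (b : ℤ)) ↔ i + 1 ≤ a := by omega
        have e4 : (0 ≤ (a : ℤ) ∧ 0 ≤ (b : ℤ) - (i + 1)) ↔ i + 1 ≤ b := by omega
        simp only [e3, e4, Int.toNat_natCast]
        split_ifs <;> simp
      · rw [if_neg (by omega), if_neg (by omega), if_neg (by omega)]; simp
    · rw [if_neg (by omega), if_neg (by omega), if_neg (by omega)]; simp

theorem scaleTwo_hn (c : ℕ) :
    scaleTwo (hn c) = ∑ p ∈ antidiagonal c,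
      Polynomial.C (Polynomial.C (hn p.1 * hn p.2) * Polynomial.X ^ p.1) * Polynomial.X ^ p.2 := by
  have h := map_hn_of_scale (R := Polynomial (Polynomial SymFun))
    (scaleTwo : SymFun →+* Polynomial (Polynomial SymFun))
    (Polynomial.C.comp (Polynomial.C : SymFun →+* Polynomial SymFun))
    (Polynomial.C Polynomial.X) Polynomial.X (fun i => by simp [scaleTwo_pw]) c
  rw [RingHom.coe_coe] at h
  rw [h]
  refine Finset.sum_congr rfl fun p _ => ?_
  simp only [RingHom.comp_apply, map_mul, map_pow]
  ring

/-! ### The coproduct with one variable split off -/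

/-- The substitution `p_i ↦ p_i + t ^ i`. -/
noncomputable def addVar : SymFun →ₐ[ℚ] Polynomial SymFun :=
  MvPolynomial.aeval fun i : ℕ+ => Polynomial.C (X i) + Polynomial.X ^ (i : ℕ)

theorem addVar_pw (i : ℕ) : addVar (pw i) = Polynomial.C (pw i) + Polynomial.X ^ (i + 1) := by
  rw [addVar, pw, MvPolynomial.aeval_X]; rfl

theorem addVar_hn (r : ℕ) :
    addVar (hn r) = ∑ p ∈ antidiagonal r, Polynomial.C (hn p.1) * Polynomial.X ^ p.2 :=
  map_hn_of_add (addVar : SymFun →+* _) Polynomial.C Polynomial.X addVar_pw r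

/-- The denominator of `H(u) / (1 - tu)` is cleared. This recursion drives the row operations in
`addVar_jt`. -/
theorem addVar_hz (r : ℤ) :
    addVar (hz r) = Polynomial.C (hz r) + Polynomial.X * addVar (hz (r - 1)) := by
  rcases lt_or_ge r 0 with h | h
  · rw [hz_of_neg h, hz_of_neg (by omega)]; simp
  · lift r to ℕ using h
    cases r with
    | zero => rw [hz_of_neg (by simp : ((0 : ℕ) : ℤ) - 1 < 0)]; simp
    | succ r =>
      have e : ((r + 1 : ℕ) : ℤ) - 1 = r := by push_cast; ring
      rw [e, hz_natCast, hz_natCast, addVar_hn, addVar_hn, Finset.Nat.antidiagonal_succ',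
        Finset.sum_cons, Finset.sum_map, Finset.mul_sum]
      simp only [pow_zero, mul_one]
      refine congrArg₂ _ rfl (Finset.sum_congr rfl fun p _ => ?_)
      change Polynomial.C (hn p.1) * Polynomial.X ^ (p.2 + 1) = _
      ring

/-! ### The Hall inner product -/

/-- The Hall inner product, for which `⟨p_λ, p_μ⟩ = δ_{λμ} z_λ`. -/
noncomputable def pairing : SymFun →ₗ[ℚ] SymFun →ₗ[ℚ] ℚ :=
  kronecker.compr₂ (MvPolynomial.aeval fun _ => (1 : ℚ)).toLinearMap

theorem pairing_apply (F G : SymFun) :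
    pairing F G = MvPolynomial.aeval (fun _ => (1 : ℚ)) (kronecker F G) := rfl

theorem pairing_pw_mul (i : ℕ) (F G : SymFun) :
    pairing (pw i * F) G = pairing F (((i : SymFun) + 1) * pderiv i.succPNat G) := by
  rw [pairing_apply, pairing_apply, kronecker_pw_mul, map_mul]
  simp [pw]

theorem pairing_C (a : ℚ) (G : SymFun) : pairing (C a) G = a * MvPolynomial.coeff 0 G := by
  have : (C a : SymFun) = a • 1 := by rw [MvPolynomial.smul_eq_C_mul, mul_one]
  rw [this, map_smul, LinearMap.smul_apply, pairing_apply, kronecker_one_left, MvPolynomial.aeval_C]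
  rfl

/-- As `zee m` is nonzero, an element orthogonal to all monomials vanishes: the pairing is
nondegenerate. -/
theorem pairing_monomial (F : SymFun) (m : ℕ+ →₀ ℕ) :
    pairing F (MvPolynomial.monomial m 1) = MvPolynomial.coeff m F * zee m := by
  classical
  induction F using MvPolynomial.induction_on' with
  | add p q hp hq => rw [map_add, LinearMap.add_apply, hp, hq, MvPolynomial.coeff_add, add_mul]
  | monomial l a =>
    have ha : MvPolynomial.monomial l a = a • MvPolynomial.monomial l (1 : ℚ) := by
      rw [MvPolynomial.smul_monomial]; simp
    rw [ha, map_smul, LinearMap.smul_apply, pairing_apply, kronecker_monomial,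
      MvPolynomial.coeff_smul, MvPolynomial.coeff_monomial]
    split_ifs with h
    · subst h
      rw [map_smul, MvPolynomial.aeval_monomial]
      simp
    · simp

/-- The product `∏_j h_{α_j}`. -/
noncomputable def hProd (α : ℕ →₀ ℕ) : SymFun := α.prod fun _ r => hn r

theorem hProd_eq (α : ℕ →₀ ℕ) (s : Finset ℕ) (h : α.support ⊆ s) :
    hProd α = ∏ j ∈ s, hn (α j) :=
  Finsupp.prod_of_support_subset _ h _ fun _ _ => hn_zero

theorem hProd_add_single (α : ℕ →₀ ℕ) (m r : ℕ) (hm : α m = 0) :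
    hProd (α + Finsupp.single m r) = hn r * hProd α := by
  rw [hProd, Finsupp.prod_add_index_of_disjoint, Finsupp.prod_single_index hn_zero, mul_comm, hProd]
  rw [Finset.disjoint_left]
  intro j hj hj'
  have := Finsupp.support_single_subset hj'
  rw [Finset.mem_singleton] at this
  subst this
  exact (Finsupp.mem_support_iff.mp hj) hm

theorem pderiv_prod_hn (i : ℕ) (α : ℕ → ℕ) (s : Finset ℕ) :
    ((i : SymFun) + 1) * pderiv i.succPNat (∏ j ∈ s, hn (α j)) =
      ∑ j ∈ s, hz (α j - (i + 1)) * ∏ k ∈ s.erase j, hn (α k) := by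
  classical
  induction s using Finset.induction_on with
  | empty => simp
  | insert a s ha ih =>
    rw [Finset.prod_insert ha, Derivation.leibniz, smul_eq_mul, smul_eq_mul, mul_add,
      mul_left_comm, ih, mul_left_comm, pderiv_hn, Finset.sum_insert ha, Finset.erase_insert ha,
      add_comm, mul_comm _ (hz _), Finset.mul_sum]
    congr 1
    refine Finset.sum_congr rfl fun j hj => ?_
    have hja : a ≠ j := fun h => ha (h ▸ hj)
    rw [Finset.erase_insert_of_ne hja, Finset.prod_insert (fun h => ha (Finset.mem_of_mem_erase h))]
    ring

theorem pderiv_hProd (i : ℕ) (α : ℕ →₀ ℕ) :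
    ((i : SymFun) + 1) * pderiv i.succPNat (hProd α) =
      ∑ j ∈ α.support, if i + 1 ≤ α j then hProd (α - Finsupp.single j (i + 1)) else 0 := by
  classical
  rw [hProd_eq α _ subset_rfl, pderiv_prod_hn]
  refine Finset.sum_congr rfl fun j hj => ?_
  split_ifs with h
  · rw [hProd_eq _ α.support, ← Finset.mul_prod_erase _ _ hj]
    · congr 1
      · have : (α j : ℤ) - (i + 1) = ((α j - (i + 1) : ℕ) : ℤ) := by omega
        rw [this, hz_natCast]
        simp
      · refine Finset.prod_congr rfl fun k hk => ?_
        rw [Finsupp.tsub_apply, Finsupp.single_eq_of_ne (Finset.ne_of_mem_erase hk), tsub_zero]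
    · exact Finsupp.support_tsub
  · rw [hz_of_neg (by omega), zero_mul]

/-- The mirror image of `pderiv_hProd`: multiplying by `p_i` subtracts `i` from one exponent of `α`.
Hence both sides of `coeff_realize` satisfy the same recursion. -/
theorem coeff_powerSum_mul (i : ℕ+) (g : MvPowerSeries ℕ ℚ) (α : ℕ →₀ ℕ) :
    MvPowerSeries.coeff α (powerSum i * g) =
      ∑ j ∈ α.support, if (i : ℕ) ≤ α j then
        MvPowerSeries.coeff (α - Finsupp.single j (i : ℕ)) g else 0 := by
  classical
  rw [MvPowerSeries.coeff_mul, ← Finset.sum_filter]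
  have hp : ∀ β, MvPowerSeries.coeff β (powerSum i) =
      if ∃ j : ℕ, β = Finsupp.single j (i : ℕ) then 1 else 0 := fun β => rfl
  simp only [hp, ite_mul, one_mul, zero_mul]
  rw [← Finset.sum_filter]
  symm
  refine Finset.sum_bij (fun j _ => (Finsupp.single j (i : ℕ), α - Finsupp.single j (i : ℕ)))
    ?_ ?_ ?_ ?_
  · intro j hj
    rw [Finset.mem_filter] at hj ⊢
    refine ⟨?_, j, rfl⟩
    rw [Finset.HasAntidiagonal.mem_antidiagonal]
    exact add_tsub_cancel_of_le (by simpa using hj.2)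
  · intro j _ k _ h
    exact Finsupp.single_left_injective i.ne_zero (Prod.ext_iff.mp h).1
  · rintro ⟨β, γ⟩ h
    rw [Finset.mem_filter, Finset.HasAntidiagonal.mem_antidiagonal] at h
    obtain ⟨h1, j, h2⟩ := h
    simp only at h1 h2
    subst h2
    have hj : (i : ℕ) ≤ α j := by rw [← h1]; simp
    refine ⟨j, ?_, ?_⟩
    · rw [Finset.mem_filter, Finsupp.mem_support_iff]
      exact ⟨(lt_of_lt_of_le i.pos hj).ne', hj⟩
    · rw [← h1, add_tsub_cancel_left]
  · intro j _
    rfl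

theorem realize_pw_mul (i : ℕ) (F : SymFun) :
    realize (pw i * F) = powerSum i.succPNat * realize F := by
  rw [map_mul, realize, pw, MvPolynomial.aeval_X]

/-- The coefficients of a symmetric function are its inner products with the products of complete
homogeneous functions. -/
theorem coeff_realize (F : SymFun) (α : ℕ →₀ ℕ) :
    MvPowerSeries.coeff α (realize F) = pairing F (hProd α) := by
  classical
  induction F using symFun_induction generalizing α with
  | hC a =>
    rw [pairing_C, ← MvPolynomial.algebraMap_eq, AlgHom.commutes, MvPowerSeries.algebraMap_apply,
      MvPowerSeries.coeff_C, ← MvPolynomial.constantCoeff_eq, hProd, Finsupp.prod, map_prod]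
    simp only [MvPolynomial.constantCoeff_eq, coeff_zero_hn]
    by_cases h : α = 0
    · subst h; simp
    · obtain ⟨j, hj⟩ := Finsupp.support_nonempty_iff.mpr h
      rw [if_neg h, Finset.prod_eq_zero hj, mul_zero]
      rw [if_neg (Finsupp.mem_support_iff.mp hj)]
  | hadd F G hF hG => rw [map_add, map_add, hF, hG, map_add, LinearMap.add_apply]
  | hmul i F hF =>
    rw [realize_pw_mul, coeff_powerSum_mul, pairing_pw_mul, pderiv_hProd, map_sum]
    refine Finset.sum_congr rfl fun j _ => ?_
    rw [Nat.succPNat_coe, Nat.succ_eq_add_one, hF]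
    split_ifs <;> simp

/-- The adjoint of multiplication by `h_r` is extraction of `t^r` after adjoining a variable `t`. On
multiplying `F` by `p_{i+1}`, the derivative of `h_r` matches the summand `t^{i+1}` and the
derivative of `G` the summand `p_{i+1}`. -/
theorem pairing_hn_mul (r : ℕ) (F G : SymFun) :
    pairing F (hn r * G) = pairing ((addVar F).coeff r) G := by
  induction F using symFun_induction generalizing r G with
  | hC a =>
    have : addVar (C a) = Polynomial.C (C a) := by
      rw [← MvPolynomial.algebraMap_eq, AlgHom.commutes]; rfl
    rw [pairing_C, this, Polynomial.coeff_C, ← MvPolynomial.constantCoeff_eq, map_mul,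
      MvPolynomial.constantCoeff_eq, coeff_zero_hn]
    split_ifs
    · rw [pairing_C, one_mul]
    · simp
  | hadd F F' hF hF' =>
    rw [map_add, LinearMap.add_apply, hF, hF', map_add, Polynomial.coeff_add, map_add,
      LinearMap.add_apply]
  | hmul i F hF =>
    have hd : ((i : SymFun) + 1) * pderiv i.succPNat (hn r * G) =
        hz (r - (i + 1)) * G + hn r * (((i : SymFun) + 1) * pderiv i.succPNat G) := by
      rw [Derivation.leibniz, smul_eq_mul, smul_eq_mul, ← pderiv_hn]
      ring
    rw [pairing_pw_mul, hd, map_add, hF, map_mul addVar, addVar_pw, add_mul (Polynomial.C _),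
      Polynomial.coeff_add,
      Polynomial.coeff_C_mul, map_add, LinearMap.add_apply, pairing_pw_mul, add_comm,
      Polynomial.coeff_X_pow_mul']
    congr 1
    split_ifs with h
    · have : (r : ℤ) - (i + 1) = ((r - (i + 1) : ℕ) : ℤ) := by omega
      rw [this, hz_natCast, hF]
    · rw [hz_of_neg (by omega)]; simp

theorem coeff_realize_add_single (F : SymFun) (α : ℕ →₀ ℕ) (m r : ℕ) (hm : α m = 0) :
    MvPowerSeries.coeff (α + Finsupp.single m r) (realize F) =
      MvPowerSeries.coeff α (realize ((addVar F).coeff r)) := by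
  rw [coeff_realize, coeff_realize, hProd_add_single _ _ _ hm, pairing_hn_mul]

/-! ### Algebraic independence of the power sums -/

/-- Newton's identities, solved for the power sum, show by strong induction that the span of the
`h_α` is closed under multiplication by every power sum. -/
theorem mem_span_hProd (F : SymFun) : F ∈ Submodule.span ℚ (Set.range hProd) := by
  set V := Submodule.span ℚ (Set.range hProd) with hV
  have hmulh : ∀ r, ∀ G ∈ V, hn r * G ∈ V := by
    intro r G hG
    induction hG using Submodule.span_induction with
    | mem x hx =>
      obtain ⟨α, rfl⟩ := hx
      -- `hProd` ignores the positions of the exponents, so the new factor `h_r` can be placed at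
      -- any unused index.
      obtain ⟨m, hm⟩ := Infinite.exists_notMem_finset α.support
      rw [← hProd_add_single α m r (by simpa using hm)]
      exact Submodule.subset_span ⟨_, rfl⟩
    | zero => rw [mul_zero]; exact V.zero_mem
    | add x y _ _ hx hy => rw [mul_add]; exact V.add_mem hx hy
    | smul a x _ hx => rw [mul_smul_comm]; exact V.smul_mem _ hx
  have hmulp : ∀ r, ∀ G ∈ V, pw r * G ∈ V := by
    intro r
    induction r using Nat.strong_induction_on with
    | _ r ih =>
      intro G hG
      have h := newton r
      rw [Finset.sum_range_succ, Nat.sub_self, hn_zero, mul_one] at h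
      have h' : pw r * G = (r + 1 : ℚ) • (hn (r + 1) * G) -
          ∑ i ∈ Finset.range r, pw i * (hn (r - i) * G) := by
        rw [MvPolynomial.smul_eq_C_mul, ← mul_assoc,
          show (C (r + 1 : ℚ) : SymFun) = (r : SymFun) + 1 by simp, h, add_mul, Finset.sum_mul]
        simp only [mul_assoc]
        ring
      rw [h']
      refine V.sub_mem (V.smul_mem _ (hmulh _ _ hG)) (V.sum_mem fun i hi => ?_)
      exact ih i (Finset.mem_range.mp hi) _ (hmulh _ _ hG)
  induction F using symFun_induction with
  | hC a =>
    have : (C a : SymFun) = a • hProd 0 := by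
      rw [MvPolynomial.smul_eq_C_mul, hProd, Finsupp.prod_zero_index, mul_one]
    rw [this]
    exact V.smul_mem _ (Submodule.subset_span ⟨_, rfl⟩)
  | hadd F G hF hG => exact V.add_mem hF hG
  | hmul i F hF => exact hmulp i F hF

/-- An `F` with zero realization is orthogonal to all `h_α` by `coeff_realize`. These span, so
nondegeneracy gives `F = 0`. -/
theorem realize_injective : Function.Injective realize := by
  rw [injective_iff_map_eq_zero]
  intro F hF
  have h : ∀ G, pairing F G = 0 := by
    intro G
    have hG := mem_span_hProd G
    induction hG using Submodule.span_induction with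
    | mem x hx =>
      obtain ⟨α, rfl⟩ := hx
      rw [← coeff_realize, hF, map_zero]
    | zero => rw [map_zero]
    | add x y _ _ hx hy => rw [map_add, hx, hy, add_zero]
    | smul a x _ hx => rw [map_smul, hx, smul_zero]
  ext m
  have h1 := h (MvPolynomial.monomial m 1)
  rw [pairing_monomial] at h1
  rw [MvPolynomial.coeff_zero]
  exact (mul_eq_zero.mp h1).resolve_right (zee_ne_zero m)

/-! ### Jacobi–Trudi determinants -/

/-- The Jacobi–Trudi determinant `det (h_{l_i - i + j})`. -/
noncomputable def jt {k : ℕ} (l : Fin k → ℤ) : SymFun :=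
  Matrix.det (Matrix.of fun i j : Fin k => hz (l i - i + j))

/-- The entry of `l` that follows the `i`-th one, and `0` after the last. -/
def nextPart {k : ℕ} (l : Fin k → ℕ) (i : Fin k) : ℕ :=
  if h : (i : ℕ) + 1 < k then l ⟨i + 1, h⟩ else 0

theorem nextPart_le {k : ℕ} {l : Fin k → ℕ} (hl : Antitone l) (i : Fin k) :
    nextPart l i ≤ l i := by
  unfold nextPart
  split_ifs with h
  · exact hl (by simp [Fin.le_def])
  · exact Nat.zero_le _

theorem addVar_hz_iterate (r : ℤ) (s : ℕ) :
    addVar (hz r) = ∑ b ∈ Finset.range s, Polynomial.X ^ b * Polynomial.C (hz (r - b)) +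
      Polynomial.X ^ s * addVar (hz (r - s)) := by
  induction s with
  | zero => simp
  | succ s ih =>
    rw [ih, Finset.sum_range_succ, addVar_hz (r - s)]
    have : r - s - 1 = r - ((s + 1 : ℕ) : ℤ) := by push_cast; ring
    rw [this]
    ring

theorem sum_Icc_eq_sum_range {R : Type*} [AddCommMonoid R] (a b : ℕ) (h : a ≤ b) (f : ℕ → ℕ → R) :
    ∑ m ∈ Finset.Icc a b, f m (b - m) = ∑ s ∈ Finset.range (b - a + 1), f (b - s) s := by
  refine Finset.sum_bij' (fun m _ => b - m) (fun s _ => b - s) ?_ ?_ ?_ ?_ ?_ <;>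
    simp only [Finset.mem_Icc, Finset.mem_range] <;> intro m hm
  · omega
  · omega
  · omega
  · omega
  · rw [Nat.sub_sub_self hm.2]

/-- The branching rule for Jacobi–Trudi determinants. -/
theorem addVar_jt {k : ℕ} (l : Fin k → ℕ) (hl : Antitone l) :
    addVar (jt fun i => (l i : ℤ)) =
      ∑ m ∈ Fintype.piFinset fun i => Finset.Icc (nextPart l i) (l i),
        Polynomial.C (jt fun i => (m i : ℤ)) * Polynomial.X ^ (∑ i, (l i - m i)) := by
  classical
  set A : Matrix (Fin k) (Fin k) (Polynomial SymFun) :=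
    Matrix.of fun i j => addVar (hz (l i - i + j)) with hA
  -- Row `i` of `A` is a sum of `t^b h_{l_i-i+j-b}` over `b ≥ 0`. Subtracting `t^{l_i-l_{i+1}+1}`
  -- times row `i + 1` removes the part with `l_i - b < l_{i+1}`; the `+ 1` in the exponent accounts
  -- for the shift `-i` becoming `-(i + 1)`.
  set U : Matrix (Fin k) (Fin k) (Polynomial SymFun) := Matrix.of fun i j =>
    if j = i then 1 else if (j : ℕ) = i + 1 then -Polynomial.X ^ (l i - l j + 1) else 0 with hU
  have h1 : addVar (jt fun i => (l i : ℤ)) = A.det := by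
    rw [jt, AlgHom.map_det]
    rfl
  have hdet : U.det = 1 := by
    rw [Matrix.det_of_isUpperTriangular]
    · simp [hU]
    · intro i j hij
      simp only [id] at hij
      have : (j : ℕ) < i := hij
      rw [hU, Matrix.of_apply, if_neg (by rintro rfl; omega), if_neg (by omega)]
  have hUA : U * A = Matrix.of fun (i j : Fin k) => ∑ m ∈ Finset.Icc (nextPart l i) (l i),
      (Polynomial.X : Polynomial SymFun) ^ (l i - m) * Polynomial.C (hz (m - i + j)) := by
    ext1 i j
    rw [Matrix.mul_apply, Matrix.of_apply,
      sum_Icc_eq_sum_range _ _ (nextPart_le hl i)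
        (fun m s => (Polynomial.X : Polynomial SymFun) ^ s * Polynomial.C (hz (m - i + j)))]
    have hr : ∀ s ∈ Finset.range (l i - nextPart l i + 1),
        (Polynomial.X : Polynomial SymFun) ^ s * Polynomial.C (hz ((l i - s : ℕ) - i + j)) =
        Polynomial.X ^ s * Polynomial.C (hz (l i - i + j - s)) := by
      intro s hs
      have := Finset.mem_range.mp hs
      have := nextPart_le hl i
      congr 3
      omega
    rw [Finset.sum_congr rfl hr, eq_sub_iff_add_eq.mpr (addVar_hz_iterate (l i - i + j)
      (l i - nextPart l i + 1)).symm]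
    by_cases h : (i : ℕ) + 1 < k
    · have hne : (⟨i + 1, h⟩ : Fin k) ≠ i := by simp [Fin.ext_iff]
      rw [Finset.sum_eq_add i ⟨i + 1, h⟩ hne.symm]
      · have hn : nextPart l i = l ⟨i + 1, h⟩ := by simp [nextPart, h]
        have hle := nextPart_le hl i
        rw [hn] at hle ⊢
        simp only [hU, hA, Matrix.of_apply, if_true, one_mul, if_neg hne]
        have e : (l ⟨i + 1, h⟩ : ℤ) - ((i + 1 : ℕ) : ℤ) + j =
            l i - i + j - ((l i - l ⟨i + 1, h⟩ + 1 : ℕ) : ℤ) := by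
          push_cast [Nat.cast_sub hle]
          ring
        rw [e]
        ring
      · intro c _ hc
        rw [hU, Matrix.of_apply, if_neg hc.1, if_neg, zero_mul]
        exact fun h' => hc.2 (Fin.ext h')
      · simp
      · simp
    · have hn : nextPart l i = 0 := by simp [nextPart, h]
      rw [Finset.sum_eq_single i]
      -- In the last row `j ≤ i`, so the tail starts at index `j - i - 1 < 0` and vanishes by
      -- itself.
      · rw [hn, hz_of_neg (r := (l i : ℤ) - i + j - ((l i - 0 + 1 : ℕ) : ℤ)) (by omega)]
        simp [hU, hA]
      · intro c _ hc
        rw [hU, Matrix.of_apply, if_neg hc, if_neg (by omega), zero_mul]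
      · simp
  have h2 : A.det = (U * A).det := by rw [Matrix.det_mul, hdet, one_mul]
  -- Each row is now a sum over an interval, and the intervals are independent; multilinearity
  -- yields one Jacobi–Trudi determinant per interlacing tuple.
  have h3 : (U * A).det = Matrix.detRowAlternating.toMultilinearMap
      (fun i => ∑ m ∈ Finset.Icc (nextPart l i) (l i),
        (Polynomial.X : Polynomial SymFun) ^ (l i - m) •
          fun j : Fin k => Polynomial.C (hz (m - i + j))) := by
    rw [hUA]
    change Matrix.det _ = Matrix.det _
    congr 1
    ext1 i j
    rw [Matrix.of_apply, Finset.sum_apply]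
    rfl
  rw [h1, h2, h3, MultilinearMap.map_sum_finset]
  refine Finset.sum_congr rfl fun m _ => ?_
  rw [MultilinearMap.map_smul_univ, Finset.prod_pow_eq_pow_sum, smul_eq_mul, mul_comm, jt,
    RingHom.map_det]
  rfl

theorem coeff_zero_jt {k : ℕ} (l : Fin k → ℕ) (hl : Antitone l) :
    MvPolynomial.coeff 0 (jt fun i => (l i : ℤ)) = if l = 0 then 1 else 0 := by
  rw [← MvPolynomial.constantCoeff_eq, jt, RingHom.map_det]
  split_ifs with h
  · rw [Matrix.det_of_isUpperTriangular]
    · refine Finset.prod_eq_one fun i _ => ?_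
      simp [h, MvPolynomial.constantCoeff_eq]
    · intro i j hij
      simp only [id] at hij
      have : (j : ℕ) < i := hij
      simp only [RingHom.mapMatrix_apply, Matrix.map_apply, Matrix.of_apply,
        MvPolynomial.constantCoeff_eq, coeff_zero_hz, h]
      rw [if_neg]
      simp
      omega
  · have h0 : ∃ i, l i ≠ 0 := by
      by_contra! h'
      exact h (funext h')
    obtain ⟨i, hi⟩ := h0
    have hk : 0 < k := i.pos
    -- The first entry of `l` is the largest, hence positive, so every `h` in the first row has
    -- positive index and no constant term.
    refine Matrix.det_eq_zero_of_row_eq_zero ⟨0, hk⟩ fun j => ?_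
    have := hl (show (⟨0, hk⟩ : Fin k) ≤ i by simp [Fin.le_def])
    simp only [RingHom.mapMatrix_apply, Matrix.map_apply, Matrix.of_apply,
      MvPolynomial.constantCoeff_eq, coeff_zero_hz]
    rw [if_neg]
    simp
    omega

/-! ### Tableaux whose shape is given by a tuple of row lengths -/

/-- The Young diagram with row lengths `l`, for a weakly decreasing tuple `l`. -/
def shape {k : ℕ} (l : Fin k → ℕ) : YoungDiagram where
  -- The bound by the sum only ensures finiteness. Imposing the condition on all rows up to `c.1`
  -- gives a lower set even for tuples `l` that are not weakly decreasing.
  cells := (Finset.range k ×ˢ Finset.range (∑ i, l i)).filter fun c =>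
    ∀ i : Fin k, (i : ℕ) ≤ c.1 → c.2 < l i
  isLowerSet := by
    rintro ⟨a, b⟩ ⟨c, d⟩ ⟨h1, h2⟩ h
    simp only [Finset.coe_filter, Finset.mem_product, Finset.mem_range, Set.mem_ofPred_eq] at h ⊢
    simp only at h1 h2
    exact ⟨⟨by omega, by omega⟩, fun i hi => lt_of_le_of_lt h2 (h.2 i (hi.trans h1))⟩

theorem mem_shape {k : ℕ} {l : Fin k → ℕ} (hl : Antitone l) {i j : ℕ} :
    (i, j) ∈ shape l ↔ ∃ h : i < k, j < l ⟨i, h⟩ := by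
  rw [← YoungDiagram.mem_cells]
  simp only [shape, Finset.mem_filter, Finset.mem_product, Finset.mem_range]
  constructor
  · rintro ⟨⟨h1, -⟩, h2⟩
    exact ⟨h1, h2 ⟨i, h1⟩ le_rfl⟩
  · rintro ⟨h1, h2⟩
    refine ⟨⟨h1, lt_of_lt_of_le h2 ?_⟩, fun i' hi' => lt_of_lt_of_le h2 (hl hi')⟩
    exact Finset.single_le_sum (f := l) (fun _ _ => Nat.zero_le _) (Finset.mem_univ _)

theorem card_cells_shape {k : ℕ} {l : Fin k → ℕ} (hl : Antitone l) :
    (shape l).cells.card = ∑ i, l i := by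
  have : ∑ i, l i = (Finset.univ.sigma fun i : Fin k => Finset.range (l i)).card := by
    simp
  rw [this]
  symm
  refine Finset.card_bij (fun p _ => ((p.1 : ℕ), p.2)) ?_ ?_ ?_
  · rintro ⟨i, j⟩ h
    rw [YoungDiagram.mem_cells, mem_shape hl]
    exact ⟨i.2, by simpa using h⟩
  · rintro ⟨i, j⟩ _ ⟨i', j'⟩ _ h
    simp only [Prod.mk.injEq, Fin.val_inj] at h
    rw [h.1, h.2]
  · rintro ⟨i, j⟩ h
    rw [YoungDiagram.mem_cells, mem_shape hl] at h
    obtain ⟨h1, h2⟩ := h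
    exact ⟨⟨⟨i, h1⟩, j⟩, by simpa using h2, rfl⟩

theorem content_apply {Y : YoungDiagram} (T : SemistandardYoungTableau Y) (v : ℕ) :
    content T v = (Y.cells.filter fun c => T c.1 c.2 = v).card := by
  classical
  rw [content, Finsupp.finsetSum_apply, Finset.card_filter]
  refine Finset.sum_congr rfl fun c _ => ?_
  rw [Finsupp.single_apply]

theorem content_apply_eq_zero_iff {Y : YoungDiagram} (T : SemistandardYoungTableau Y) (v : ℕ) :
    content T v = 0 ↔ ∀ i j, (i, j) ∈ Y → T i j ≠ v := by
  rw [content_apply, Finset.card_eq_zero, Finset.filter_eq_empty_iff]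
  constructor
  · intro h i j hij
    exact h ((YoungDiagram.mem_cells _).mpr hij)
  · rintro h ⟨i, j⟩ hij
    exact h i j ((YoungDiagram.mem_cells _).mp hij)

/-- The tuples `m` that interlace with `l`, i.e. for which `l / m` is a horizontal strip. -/
def interlacing {k : ℕ} (l : Fin k → ℕ) : Finset (Fin k → ℕ) :=
  Fintype.piFinset fun i => Finset.Icc (nextPart l i) (l i)

theorem le_of_mem_interlacing {k : ℕ} {l m : Fin k → ℕ} (hm : m ∈ interlacing l) (i : Fin k) :
    m i ≤ l i :=
  (Finset.mem_Icc.mp (Fintype.mem_piFinset.mp hm i)).2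

theorem le_of_mem_interlacing_of_lt {k : ℕ} {l m : Fin k → ℕ} (hl : Antitone l)
    (hm : m ∈ interlacing l) {i i' : Fin k} (h : i < i') : l i' ≤ m i := by
  refine le_trans ?_ (Finset.mem_Icc.mp (Fintype.mem_piFinset.mp hm i)).1
  have h' : (i : ℕ) < i' := h
  have hk : (i : ℕ) + 1 < k := by omega
  rw [nextPart, dif_pos hk]
  exact hl (by simp [Fin.le_def]; omega)

theorem antitone_of_mem_interlacing {k : ℕ} {l m : Fin k → ℕ} (hl : Antitone l)
    (hm : m ∈ interlacing l) : Antitone m := by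
  intro i i' h
  rcases eq_or_lt_of_le h with rfl | h
  · exact le_rfl
  · exact (le_of_mem_interlacing hm i').trans (le_of_mem_interlacing_of_lt hl hm h)

theorem shape_le_of_mem_interlacing {k : ℕ} {l m : Fin k → ℕ} (hl : Antitone l)
    (hm : m ∈ interlacing l) {i j : ℕ} (h : (i, j) ∈ shape m) : (i, j) ∈ shape l := by
  rw [mem_shape (antitone_of_mem_interlacing hl hm)] at h
  obtain ⟨h1, h2⟩ := h
  exact (mem_shape hl).mpr ⟨h1, h2.trans_le (le_of_mem_interlacing hm _)⟩

open Classical in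
/-- Extend a tableau of shape `m` with entries less than `b` to one of shape `l`, by filling the
horizontal strip `l / m` with entries `b`. -/
noncomputable def extendTableau {k : ℕ} {l m : Fin k → ℕ} (hl : Antitone l)
    (hm : m ∈ interlacing l) (b : ℕ) (T : SemistandardYoungTableau (shape m))
    (hT : ∀ i j, (i, j) ∈ shape m → T i j < b) : SemistandardYoungTableau (shape l) where
  entry i j := if (i, j) ∈ shape m then T i j else if (i, j) ∈ shape l then b else 0
  row_weak' := by
    intro i j1 j2 hj h
    by_cases h2 : (i, j2) ∈ shape m
    · have h1 := (shape m).up_left_mem le_rfl hj.le h2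
      rw [if_pos h1, if_pos h2]
      exact T.row_weak hj h2
    · rw [if_neg h2, if_pos h]
      split_ifs with h1
      · exact (hT _ _ h1).le
      · exact le_rfl
      · exact Nat.zero_le _
  col_strict' := by
    intro i1 i2 j hi h
    have hm' := antitone_of_mem_interlacing hl hm
    have h1 : (i1, j) ∈ shape m := by
      obtain ⟨h1, h2⟩ := (mem_shape hl).mp h
      exact (mem_shape hm').mpr ⟨hi.trans h1, h2.trans_le (le_of_mem_interlacing_of_lt hl hm hi)⟩
    rw [if_pos h1]
    split_ifs with h2
    · exact T.col_strict hi h2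
    · exact hT _ _ h1
  zeros' := by
    intro i j h
    rw [if_neg fun h' => h (shape_le_of_mem_interlacing hl hm h'), if_neg h]

theorem extendTableau_of_mem {k : ℕ} {l m : Fin k → ℕ} (hl : Antitone l)
    (hm : m ∈ interlacing l) (b : ℕ) (T : SemistandardYoungTableau (shape m))
    (hT : ∀ i j, (i, j) ∈ shape m → T i j < b) {i j : ℕ} (h : (i, j) ∈ shape m) :
    extendTableau hl hm b T hT i j = T i j :=
  if_pos h

theorem extendTableau_of_notMem {k : ℕ} {l m : Fin k → ℕ} (hl : Antitone l)
    (hm : m ∈ interlacing l) (b : ℕ) (T : SemistandardYoungTableau (shape m))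
    (hT : ∀ i j, (i, j) ∈ shape m → T i j < b) {i j : ℕ} (h : (i, j) ∉ shape m)
    (h' : (i, j) ∈ shape l) : extendTableau hl hm b T hT i j = b :=
  (if_neg h).trans (if_pos h')

theorem extendTableau_lt_iff {k : ℕ} {l m : Fin k → ℕ} (hl : Antitone l)
    (hm : m ∈ interlacing l) (b : ℕ) (T : SemistandardYoungTableau (shape m))
    (hT : ∀ i j, (i, j) ∈ shape m → T i j < b) (i j : ℕ) :
    ((i, j) ∈ shape l ∧ extendTableau hl hm b T hT i j < b) ↔ (i, j) ∈ shape m := by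
  constructor
  · rintro ⟨h1, h2⟩
    by_contra h
    rw [extendTableau_of_notMem hl hm b T hT h h1] at h2
    exact lt_irrefl _ h2
  · intro h
    refine ⟨shape_le_of_mem_interlacing hl hm h, ?_⟩
    rw [extendTableau_of_mem hl hm b T hT h]
    exact hT i j h

theorem sum_sub_of_mem_interlacing {k : ℕ} {l m : Fin k → ℕ} (hm : m ∈ interlacing l) :
    ∑ i, (l i - m i) = ∑ i, l i - ∑ i, m i :=
  Finset.sum_tsub_distrib _ fun i _ => le_of_mem_interlacing hm i

theorem content_extendTableau {k : ℕ} {l m : Fin k → ℕ} (hl : Antitone l)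
    (hm : m ∈ interlacing l) (b : ℕ) (T : SemistandardYoungTableau (shape m))
    (hT : ∀ i j, (i, j) ∈ shape m → T i j < b) :
    content (extendTableau hl hm b T hT) =
      content T + Finsupp.single b (∑ i, (l i - m i)) := by
  classical
  have hm' := antitone_of_mem_interlacing hl hm
  have hsub : (shape m).cells ⊆ (shape l).cells := fun c hc =>
    (YoungDiagram.mem_cells _).mpr
      (shape_le_of_mem_interlacing hl hm ((YoungDiagram.mem_cells _).mp hc))
  rw [content, content, ← Finset.sum_sdiff hsub, add_comm]
  congr 1
  · refine Finset.sum_congr rfl fun c hc => ?_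
    rw [extendTableau_of_mem hl hm b T hT ((YoungDiagram.mem_cells _).mp hc)]
  · have : ∀ c ∈ (shape l).cells \ (shape m).cells,
        Finsupp.single (extendTableau hl hm b T hT c.1 c.2) 1 = Finsupp.single b 1 := by
      intro c hc
      rw [Finset.mem_sdiff] at hc
      rw [extendTableau_of_notMem hl hm b T hT
        (fun h => hc.2 ((YoungDiagram.mem_cells _).mpr h)) ((YoungDiagram.mem_cells _).mp hc.1)]
    rw [Finset.sum_congr rfl this, Finset.sum_const, Finset.card_sdiff_of_subset hsub,
      card_cells_shape hl, card_cells_shape hm', sum_sub_of_mem_interlacing hm,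
      Finsupp.smul_single, smul_eq_mul, mul_one]

/-- Every tableau with entries at most `b` arises by extending one with entries less than `b`. -/
theorem exists_extendTableau {k : ℕ} {l : Fin k → ℕ} (hl : Antitone l) (b : ℕ)
    (T : SemistandardYoungTableau (shape l)) (hT : ∀ i j, (i, j) ∈ shape l → T i j ≤ b) :
    ∃ (m : Fin k → ℕ) (hm : m ∈ interlacing l) (T' : SemistandardYoungTableau (shape m))
      (hT' : ∀ i j, (i, j) ∈ shape m → T' i j < b), extendTableau hl hm b T' hT' = T := by
  classical
  let Y : YoungDiagram :=
    { cells := (shape l).cells.filter fun c => T c.1 c.2 < b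
      isLowerSet := by
        rintro ⟨i2, j2⟩ ⟨i1, j1⟩ ⟨h1, h2⟩ h
        simp only [Finset.coe_filter, Set.mem_ofPred_eq, YoungDiagram.mem_cells] at h ⊢
        simp only at h1 h2
        refine ⟨(shape l).up_left_mem h1 h2 h.1, lt_of_le_of_lt ?_ h.2⟩
        exact (T.row_weak_of_le h2 ((shape l).up_left_mem h1 le_rfl h.1)).trans
          (T.col_weak h1 h.1) }
  have hY : ∀ i j, (i, j) ∈ Y ↔ (i, j) ∈ shape l ∧ T i j < b := by
    intro i j
    rw [← YoungDiagram.mem_cells]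
    simp only [Y, Finset.mem_filter, YoungDiagram.mem_cells]
  -- Columns are strict and entries are at most `b`, so a cell directly above another cell of the
  -- shape has entry less than `b`. Hence at most one `b` occurs per column, which is the lower
  -- interlacing bound.
  have hm : (fun i : Fin k => Y.rowLen i) ∈ interlacing l := by
    rw [interlacing, Fintype.mem_piFinset]
    intro i
    rw [Finset.mem_Icc]
    constructor
    · unfold nextPart
      split_ifs with h
      · by_contra! hlt
        have h1 : ((i : ℕ) + 1, Y.rowLen i) ∈ shape l := (mem_shape hl).mpr ⟨h, hlt⟩
        have h2 : ((i : ℕ), Y.rowLen i) ∈ Y := (hY _ _).mpr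
          ⟨(shape l).up_left_mem (Nat.le_succ _) le_rfl h1,
            lt_of_lt_of_le (T.col_strict (Nat.lt_succ_self _) h1) (hT _ _ h1)⟩
        exact lt_irrefl _ (YoungDiagram.mem_iff_lt_rowLen.mp h2)
      · exact Nat.zero_le _
    · by_contra! hlt
      have h1 := ((hY _ _).mp (YoungDiagram.mem_iff_lt_rowLen.mpr hlt)).1
      obtain ⟨_, h2⟩ := (mem_shape hl).mp h1
      exact lt_irrefl _ h2
  have hm' := antitone_of_mem_interlacing hl hm
  have hmem : ∀ i j, (i, j) ∈ shape (fun i : Fin k => Y.rowLen i) ↔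
      (i, j) ∈ shape l ∧ T i j < b := by
    intro i j
    rw [mem_shape hm', ← hY, YoungDiagram.mem_iff_lt_rowLen]
    constructor
    · rintro ⟨_, h⟩
      exact h
    · intro h
      have h1 := ((hY _ _).mp (YoungDiagram.mem_iff_lt_rowLen.mpr h)).1
      exact ⟨((mem_shape hl).mp h1).1, h⟩
  let T' : SemistandardYoungTableau (shape fun i : Fin k => Y.rowLen i) :=
    { entry := fun i j => if (i, j) ∈ shape (fun i : Fin k => Y.rowLen i) then T i j else 0
      row_weak' := by
        intro i j1 j2 hj h
        rw [if_pos h, if_pos ((shape _).up_left_mem le_rfl hj.le h)]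
        exact T.row_weak hj ((hmem _ _).mp h).1
      col_strict' := by
        intro i1 i2 j hi h
        rw [if_pos h, if_pos ((shape _).up_left_mem hi.le le_rfl h)]
        exact T.col_strict hi ((hmem _ _).mp h).1
      zeros' := fun h => if_neg h }
  have hT'eq : ∀ i j, (i, j) ∈ shape (fun i : Fin k => Y.rowLen i) → T' i j = T i j :=
    fun i j h => if_pos h
  have hT' : ∀ i j, (i, j) ∈ shape (fun i : Fin k => Y.rowLen i) → T' i j < b := by
    intro i j h
    rw [hT'eq i j h]
    exact ((hmem _ _).mp h).2
  refine ⟨_, hm, T', hT', SemistandardYoungTableau.ext fun i j => ?_⟩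
  by_cases h : (i, j) ∈ shape (fun i : Fin k => Y.rowLen i)
  · rw [extendTableau_of_mem hl hm b T' hT' h, hT'eq i j h]
  · by_cases h' : (i, j) ∈ shape l
    · rw [extendTableau_of_notMem hl hm b T' hT' h h']
      have : ¬ T i j < b := fun hlt => h ((hmem _ _).mpr ⟨h', hlt⟩)
      exact le_antisymm (not_lt.mp this) (hT i j h')
    · rw [SemistandardYoungTableau.zeros _ h', SemistandardYoungTableau.zeros _ h']

theorem lt_of_content_eq {Y : YoungDiagram} {T : SemistandardYoungTableau Y} {α : ℕ →₀ ℕ} {b : ℕ}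
    (hα : ∀ v, b ≤ v → α v = 0) (h : content T = α) (i j : ℕ) (hij : (i, j) ∈ Y) : T i j < b := by
  by_contra! hb
  have := hα _ hb
  rw [← h, content_apply_eq_zero_iff] at this
  exact this i j hij rfl

/-- The branching rule for numbers of tableaux. -/
theorem card_tableaux_add_single {k : ℕ} {l : Fin k → ℕ} (hl : Antitone l) (α : ℕ →₀ ℕ) (b r : ℕ)
    (hα : ∀ v, b ≤ v → α v = 0) :
    Nat.card {T : SemistandardYoungTableau (shape l) // content T = α + Finsupp.single b r} =
      ∑ m ∈ (interlacing l).filter (fun m => ∑ i, (l i - m i) = r),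
        Nat.card {T : SemistandardYoungTableau (shape m) // content T = α} := by
  classical
  set I := (interlacing l).filter (fun m => ∑ i, (l i - m i) = r) with hIdef
  have hI : ∀ m : I, m.1 ∈ interlacing l ∧ ∑ i, (l i - m.1 i) = r :=
    fun m => Finset.mem_filter.mp m.2
  let f : (Σ m : I, {T : SemistandardYoungTableau (shape m.1) // content T = α}) →
      {T : SemistandardYoungTableau (shape l) // content T = α + Finsupp.single b r} :=
    fun p => ⟨extendTableau hl (hI p.1).1 b p.2.1 (lt_of_content_eq hα p.2.2), by
      rw [content_extendTableau, p.2.2, (hI p.1).2]⟩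
  have hf : Function.Bijective f := by
    constructor
    · rintro ⟨⟨m, hm⟩, T, hT⟩ ⟨⟨m', hm'⟩, T', hT'⟩ h
      have h1 : ∀ i j, extendTableau hl (hI ⟨m, hm⟩).1 b T (lt_of_content_eq hα hT) i j =
          extendTableau hl (hI ⟨m', hm'⟩).1 b T' (lt_of_content_eq hα hT') i j := by
        intro i j
        exact congrArg (fun S : SemistandardYoungTableau (shape l) => S i j) (Subtype.ext_iff.mp h)
      have ha := antitone_of_mem_interlacing hl (hI ⟨m, hm⟩).1
      have ha' := antitone_of_mem_interlacing hl (hI ⟨m', hm'⟩).1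
      -- The inner shape is recovered from the extended tableau as the set of cells with entry less
      -- than `b`.
      have h2 : ∀ i j, (i, j) ∈ shape m ↔ (i, j) ∈ shape m' := by
        intro i j
        rw [← extendTableau_lt_iff hl (hI ⟨m, hm⟩).1 b T (lt_of_content_eq hα hT), h1,
          extendTableau_lt_iff hl (hI ⟨m', hm'⟩).1 b T' (lt_of_content_eq hα hT')]
      have h3 : m = m' := by
        funext i
        have h4 : ∀ j, j < m i ↔ j < m' i := by
          intro j
          have := h2 i j
          rw [mem_shape ha, mem_shape ha'] at this
          simpa using this
        exact le_antisymm (not_lt.mp fun h => lt_irrefl _ ((h4 _).mp h))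
          (not_lt.mp fun h => lt_irrefl _ ((h4 _).mpr h))
      subst h3
      have h5 : T = T' := by
        refine SemistandardYoungTableau.ext fun i j => ?_
        by_cases hij : (i, j) ∈ shape m
        · have := h1 i j
          rwa [extendTableau_of_mem _ _ _ _ _ hij, extendTableau_of_mem _ _ _ _ _ hij] at this
        · rw [T.zeros hij, T'.zeros hij]
      subst h5
      rfl
    · rintro ⟨T, hT⟩
      have hle : ∀ i j, (i, j) ∈ shape l → T i j ≤ b := by
        intro i j hij
        refine Nat.lt_succ_iff.mp (lt_of_content_eq ?_ hT i j hij)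
        intro v hv
        rw [Finsupp.add_apply, hα v (by omega), Finsupp.single_eq_of_ne (by omega), add_zero]
      obtain ⟨m, hm, T', hT', rfl⟩ := exists_extendTableau hl b T hle
      rw [content_extendTableau] at hT
      have h0 : content T' b = 0 := by
        rw [content_apply_eq_zero_iff]
        exact fun i j hij => (hT' i j hij).ne
      have hr : ∑ i, (l i - m i) = r := by
        have := DFunLike.congr_fun hT b
        simpa [h0, hα b le_rfl] using this
      rw [hr] at hT
      exact ⟨⟨⟨m, Finset.mem_filter.mpr ⟨hm, hr⟩⟩, T', add_right_cancel hT⟩, rfl⟩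
  have hfin : ∀ m : I, Finite {T : SemistandardYoungTableau (shape m.1) // content T = α} :=
    fun m => finite_content_eq _ _
  rw [← Nat.card_congr (Equiv.ofBijective f hf), Nat.card_sigma]
  exact Finset.sum_coe_sort I
    (fun m => Nat.card {T : SemistandardYoungTableau (shape m) // content T = α})

theorem card_tableaux_zero {k : ℕ} {l : Fin k → ℕ} (hl : Antitone l) :
    Nat.card {T : SemistandardYoungTableau (shape l) // content T = 0} =
      if l = 0 then 1 else 0 := by
  have hzero : ∀ T : SemistandardYoungTableau (shape l), content T = 0 → l = 0 := by
    intro T hT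
    funext i
    by_contra h
    have h1 : ((i : ℕ), 0) ∈ shape l := (mem_shape hl).mpr ⟨i.2, Nat.pos_of_ne_zero h⟩
    exact absurd (lt_of_content_eq (b := 0) (fun _ _ => rfl) hT _ _ h1) (Nat.not_lt_zero _)
  split_ifs with h
  · subst h
    have hempty : ∀ i j, (i, j) ∉ shape (0 : Fin k → ℕ) := by
      intro i j hij
      obtain ⟨_, h⟩ := (mem_shape hl).mp hij
      exact absurd h (Nat.not_lt_zero _)
    rw [Nat.card_eq_one_iff_unique]
    refine ⟨⟨fun S T => Subtype.ext (SemistandardYoungTableau.ext fun i j => ?_)⟩,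
      ⟨⟨SemistandardYoungTableau.highestWeight _, ?_⟩⟩⟩
    · rw [S.1.zeros (hempty i j), T.1.zeros (hempty i j)]
    · rw [content]
      refine Finset.sum_eq_zero fun c hc => absurd ((YoungDiagram.mem_cells _).mp hc) (hempty _ _)
  · rw [Nat.card_eq_zero]
    exact Or.inl ⟨fun T => h (hzero T.1 T.2)⟩

theorem coeff_zero_realize (F : SymFun) :
    MvPowerSeries.coeff 0 (realize F) = MvPolynomial.coeff 0 F := by
  rw [coeff_realize, hProd, Finsupp.prod_zero_index,
    show (1 : SymFun) = MvPolynomial.monomial 0 1 from rfl, pairing_monomial]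
  simp [zee]

/-- The Jacobi–Trudi formula. -/
theorem card_tableaux_eq_coeff_jt {k : ℕ} (b : ℕ) (l : Fin k → ℕ) (hl : Antitone l) (α : ℕ →₀ ℕ)
    (hα : ∀ v, b ≤ v → α v = 0) :
    (Nat.card {T : SemistandardYoungTableau (shape l) // content T = α} : ℚ) =
      MvPowerSeries.coeff α (realize (jt fun i => (l i : ℤ))) := by
  induction b generalizing l α with
  | zero =>
    obtain rfl : α = 0 := Finsupp.ext fun v => hα v (Nat.zero_le v)
    rw [coeff_zero_realize, coeff_zero_jt l hl, card_tableaux_zero hl]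
    split_ifs <;> simp
  | succ b ih =>
    have hα' : ∀ v, b ≤ v → α.erase b v = 0 := by
      intro v hv
      rcases eq_or_lt_of_le hv with rfl | hv
      · exact Finsupp.erase_same
      · rw [Finsupp.erase_ne (by omega), hα v hv]
    -- Removing the largest possible entry `b` from tableaux and splitting off the variable `x_b`
    -- from the determinant give the same sum, over interlacing tuples of size smaller by `α b`.
    rw [← Finsupp.erase_add_single b α, card_tableaux_add_single hl _ _ _ hα',
      coeff_realize_add_single _ _ _ _ (hα' b le_rfl), addVar_jt l hl, Polynomial.finsetSum_coeff]
    simp only [Polynomial.coeff_C_mul, Polynomial.coeff_X_pow, mul_ite, mul_one, mul_zero]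
    rw [← Finset.sum_filter, map_sum, map_sum, Nat.cast_sum]
    simp only [interlacing, eq_comm (a := α b)]
    refine Finset.sum_congr rfl fun m hm => ih m ?_ _ hα'
    exact antitone_of_mem_interlacing hl (Finset.mem_filter.mp hm).1

/-! ### Schur functions of partitions as Jacobi–Trudi determinants -/

theorem part_antitone {N : ℕ} (p : N.Partition) {i j : ℕ} (h : i ≤ j) :
    part p (j + 1) ≤ part p (i + 1) := by
  have hs : (sortedParts p).Pairwise (· ≥ ·) := p.parts.pairwise_sort (· ≥ ·)
  rw [part, part, Nat.add_sub_cancel, Nat.add_sub_cancel]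
  rcases eq_or_lt_of_le h with rfl | h
  · exact le_rfl
  by_cases hj : j < (sortedParts p).length
  · rw [List.getD_eq_getElem _ _ hj, List.getD_eq_getElem _ _ (h.trans hj)]
    exact List.pairwise_iff_getElem.mp hs i j (h.trans hj) hj h
  · rw [List.getD_eq_default _ _ (not_lt.mp hj)]
    exact Nat.zero_le _

theorem length_sortedParts {N : ℕ} (p : N.Partition) : (sortedParts p).length = length p :=
  Multiset.length_sort _

theorem mem_diagram {N : ℕ} (p : N.Partition) (i j : ℕ) :
    (i, j) ∈ diagram p ↔ j < part p (i + 1) := by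
  rw [part, Nat.add_sub_cancel]
  refine (YoungDiagram.mem_ofRowLens (w := sortedParts p)
    (hw := (p.parts.pairwise_sort (· ≥ ·)).sortedGE) (c := (i, j))).trans ?_
  constructor
  · rintro ⟨h1, h2⟩
    rwa [List.getD_eq_getElem _ _ h1]
  · intro h2
    by_cases h : i < (sortedParts p).length
    · rw [List.getD_eq_getElem _ _ h] at h2
      exact ⟨h, h2⟩
    · rw [List.getD_eq_default _ _ (not_lt.mp h)] at h2
      exact absurd h2 (Nat.not_lt_zero _)

theorem part_eq_zero {N : ℕ} (p : N.Partition) {i : ℕ} (h : length p ≤ i) : part p (i + 1) = 0 := by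
  rw [part, Nat.add_sub_cancel]
  exact List.getD_eq_default _ _ ((length_sortedParts p).trans_le h)

theorem diagram_eq_shape {N : ℕ} (p : N.Partition) (k : ℕ) (hk : length p ≤ k) :
    diagram p = shape fun i : Fin k => part p (i + 1) := by
  have ha : Antitone fun i : Fin k => part p (i + 1) := fun i j h => part_antitone p h
  ext1
  ext ⟨i, j⟩
  rw [YoungDiagram.mem_cells, YoungDiagram.mem_cells, mem_shape ha, mem_diagram]
  constructor
  · intro h
    refine ⟨?_, h⟩
    by_contra! h'
    rw [part_eq_zero p (hk.trans h')] at h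
    exact absurd h (Nat.not_lt_zero _)
  · rintro ⟨_, h⟩
    exact h

/-- Schur functions are Jacobi–Trudi determinants. -/
theorem schur_eq_realize_jt {N : ℕ} (p : N.Partition) (k : ℕ) (hk : length p ≤ k) :
    schur p = realize (jt fun i : Fin k => (part p (i + 1) : ℤ)) := by
  have ha : Antitone fun i : Fin k => part p (i + 1) := fun i j h => part_antitone p h
  ext α
  obtain ⟨b, hb⟩ : ∃ b, ∀ v, b ≤ v → α v = 0 := by
    refine ⟨α.support.sup id + 1, fun v hv => ?_⟩
    by_contra h
    have := Finset.le_sup (f := id) (Finsupp.mem_support_iff.mpr h)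
    simp only [id] at this
    omega
  rw [← card_tableaux_eq_coeff_jt b _ ha α hb, ← diagram_eq_shape p k hk]
  rfl

/-! ### Linear independence of the Schur functions -/

theorem part_pos {N : ℕ} (p : N.Partition) {x : ℕ} (h : x ∈ sortedParts p) : 0 < x :=
  p.parts_pos (by simpa [sortedParts] using h)

theorem eq_of_part_eq {N : ℕ} {p q : N.Partition} (h : ∀ i, part p (i + 1) = part q (i + 1)) :
    p = q := by
  have hd : diagram p = diagram q := by
    ext1
    ext ⟨i, j⟩
    rw [YoungDiagram.mem_cells, YoungDiagram.mem_cells, mem_diagram, mem_diagram, h]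
  have hr : ∀ r : N.Partition, (diagram r).rowLens = sortedParts r := fun r =>
    YoungDiagram.rowLens_ofRowLens_eq_self (w := sortedParts r)
      (hw := (r.parts.pairwise_sort (· ≥ ·)).sortedGE) fun x hx => part_pos r hx
  have hs : sortedParts p = sortedParts q := by rw [← hr, ← hr, hd]
  have hp : ∀ r : N.Partition, (sortedParts r : Multiset ℕ) = r.parts := fun r =>
    Multiset.sort_eq _ _
  exact Nat.Partition.ext (by rw [← hp, ← hp, hs])

theorem length_le {N : ℕ} (p : N.Partition) : length p ≤ N := by
  have := Multiset.card_nsmul_le_sum (s := p.parts) (a := 1) fun x hx => p.parts_pos hx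
  rwa [p.parts_sum, smul_eq_mul, mul_one] at this

theorem rowLen_diagram {N : ℕ} (p : N.Partition) (i : ℕ) :
    (diagram p).rowLen i = part p (i + 1) := by
  have h : ∀ j, j < (diagram p).rowLen i ↔ j < part p (i + 1) := fun j => by
    rw [← YoungDiagram.mem_iff_lt_rowLen, mem_diagram]
  exact le_antisymm (not_lt.mp fun h' => lt_irrefl _ ((h _).mp h'))
    (not_lt.mp fun h' => lt_irrefl _ ((h _).mpr h'))

/-- A partition as an exponent vector. -/
noncomputable def exponent {N : ℕ} (p : N.Partition) : ℕ →₀ ℕ :=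
  Finsupp.onFinset (Finset.range N) (fun i => part p (i + 1)) fun i hi => by
    rw [Finset.mem_range]
    by_contra! h
    exact hi (part_eq_zero p ((length_le p).trans h))

theorem content_highestWeight {N : ℕ} (p : N.Partition) :
    content (SemistandardYoungTableau.highestWeight (diagram p)) = exponent p := by
  ext v
  rw [content_apply]
  refine Eq.trans ?_ (rowLen_diagram p v)
  rw [YoungDiagram.rowLen_eq_card, YoungDiagram.row]
  congr 1
  refine Finset.filter_congr fun c hc => ?_
  rw [SemistandardYoungTableau.highestWeight_apply, if_pos ((YoungDiagram.mem_cells _).mp hc)]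

theorem row_le_entry {Y : YoungDiagram} (T : SemistandardYoungTableau Y) (i j : ℕ)
    (h : (i, j) ∈ Y) : i ≤ T i j := by
  induction i with
  | zero => exact Nat.zero_le _
  | succ i ih =>
    have h1 : T i j < T (i + 1) j := T.col_strict (Nat.lt_succ_self i) h
    have h2 := ih (Y.up_left_mem (Nat.le_succ i) le_rfl h)
    omega

/-- If there is a tableau of shape `p` and content `q` then `p` dominates `q`. -/
theorem sum_part_le_of_content_eq {N : ℕ} {p q : N.Partition}
    (T : SemistandardYoungTableau (diagram p)) (hT : content T = exponent q) (s : ℕ) :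
    ∑ i ∈ Finset.range s, part q (i + 1) ≤ ∑ i ∈ Finset.range s, part p (i + 1) := by
  have h1 : ∑ i ∈ Finset.range s, part q (i + 1) =
      ((diagram p).cells.filter fun c => T c.1 c.2 ∈ Finset.range s).card := by
    rw [Finset.card_eq_sum_card_fiberwise (f := fun c : ℕ × ℕ => T c.1 c.2) (t := Finset.range s)
      (fun c hc => Finset.mem_coe.mpr (Finset.mem_filter.mp (Finset.mem_coe.mp hc)).2)]
    refine Finset.sum_congr rfl fun v hv => ?_
    have : part q (v + 1) = content T v := by rw [hT]; rfl
    rw [this, content_apply, Finset.filter_filter]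
    congr 1
    refine Finset.filter_congr fun c _ => ⟨fun h => ⟨by rw [← h] at hv; exact hv, h⟩, fun h => h.2⟩
  have h2 : ∑ i ∈ Finset.range s, part p (i + 1) =
      ((diagram p).cells.filter fun c => c.1 ∈ Finset.range s).card := by
    rw [Finset.card_eq_sum_card_fiberwise (f := fun c : ℕ × ℕ => c.1) (t := Finset.range s)
      (fun c hc => Finset.mem_coe.mpr (Finset.mem_filter.mp (Finset.mem_coe.mp hc)).2)]
    refine Finset.sum_congr rfl fun v hv => ?_
    rw [← rowLen_diagram, YoungDiagram.rowLen_eq_card, YoungDiagram.row, Finset.filter_filter]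
    congr 1
    refine Finset.filter_congr fun c _ => ⟨fun h => ⟨by rw [← h] at hv; exact hv, h⟩, fun h => h.2⟩
  rw [h1, h2]
  -- The entry in row `i` is at least `i`, so entries less than `s` lie in the first `s` rows.
  refine Finset.card_le_card fun c hc => ?_
  rw [Finset.mem_filter, Finset.mem_range] at hc ⊢
  exact ⟨hc.1, (row_le_entry T _ _ ((YoungDiagram.mem_cells _).mp hc.1)).trans_lt hc.2⟩

/-- A statistic on partitions that is strictly monotone for the dominance order. -/
def dominanceWeight {N : ℕ} (p : N.Partition) : ℕ :=
  ∑ s ∈ Finset.range (N + 1), ∑ i ∈ Finset.range s, part p (i + 1)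

theorem eq_of_dominates {N : ℕ} {p q : N.Partition}
    (h : ∀ s, ∑ i ∈ Finset.range s, part q (i + 1) ≤ ∑ i ∈ Finset.range s, part p (i + 1))
    (hw : dominanceWeight p ≤ dominanceWeight q) : p = q := by
  have heq := (Finset.sum_eq_sum_iff_of_le fun s _ => h s).mp
    (le_antisymm (Finset.sum_le_sum fun s _ => h s) hw)
  refine eq_of_part_eq fun i => ?_
  rcases lt_or_ge i N with hi | hi
  · have h1 := heq i (Finset.mem_range.mpr (by omega))
    have h2 := heq (i + 1) (Finset.mem_range.mpr (by omega))
    rw [Finset.sum_range_succ, Finset.sum_range_succ] at h2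
    omega
  · rw [part_eq_zero p ((length_le p).trans hi), part_eq_zero q ((length_le q).trans hi)]

theorem coeff_schur {N : ℕ} (p : N.Partition) (α : ℕ →₀ ℕ) : MvPowerSeries.coeff α (schur p) =
    (Nat.card {T : SemistandardYoungTableau (diagram p) // content T = α} : ℚ) := rfl

/-- Triangularity of the Kostka numbers: if `q` has maximal `dominanceWeight` among the partitions
occurring in a relation, the monomial `exponent q` occurs in no other `s_p` of the relation, while
the highest weight tableau makes it occur in `s_q`. -/
theorem linearIndependent_schur (N : ℕ) :
    LinearIndependent ℚ (schur : N.Partition → MvPowerSeries ℕ ℚ) := by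
  rw [Fintype.linearIndependent_iff]
  intro c hc
  by_contra! hne
  obtain ⟨p₀, hp₀⟩ := hne
  obtain ⟨q, hq, hmax⟩ := Finset.exists_max_image
    (Finset.univ.filter fun p : N.Partition => c p ≠ 0) dominanceWeight
    ⟨p₀, by simpa using hp₀⟩
  have hq' : c q ≠ 0 := by simpa using hq
  have h := congrArg (MvPowerSeries.coeff (exponent q)) hc
  rw [map_sum, map_zero, Finset.sum_eq_single q] at h
  · rw [map_smul, smul_eq_mul, coeff_schur] at h
    have hcard := (mul_eq_zero.mp h).resolve_left hq'
    have := finite_content_eq (diagram q) (exponent q)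
    rw [Nat.cast_eq_zero, Finite.card_eq_zero_iff] at hcard
    exact hcard.false ⟨_, content_highestWeight q⟩
  · intro p _ hpq
    rw [map_smul, smul_eq_mul, coeff_schur, mul_eq_zero]
    by_contra! hp
    have hne : Nat.card {T : SemistandardYoungTableau (diagram p) // content T = exponent q} ≠ 0 :=
      fun h0 => hp.2 (by rw [h0, Nat.cast_zero])
    obtain ⟨⟨T, hT⟩⟩ := (Nat.card_ne_zero.mp hne).1
    exact hpq (eq_of_dominates (sum_part_le_of_content_eq T hT) (hmax p (by simpa using hp.1)))
  · simp

/-! ### A Pfaffian summation formula -/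

section Pfaffian

variable {R : Type*} [CommRing R]

/-- The `2 × 2` minors of two vectors, summed over all pairs of vectors with index less than `M`. -/
def wedgeTwo (v : ℕ → Fin 4 → R) (M : ℕ) (j k : Fin 4) : R :=
  ∑ b ∈ Finset.range M, ∑ a ∈ Finset.range b, (v a j * v b k - v a k * v b j)

/-- A `3 × 3` minor. -/
def minorThree (x y z : Fin 4 → R) (j k l : Fin 4) : R :=
  (x j * y k - x k * y j) * z l - (x j * y l - x l * y j) * z k + (x k * y l - x l * y k) * z j

/-- A `4 × 4` determinant, expanded along its last row. -/
def detFour (x y z w : Fin 4 → R) : R :=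
  minorThree x y z 0 1 2 * w 3 - minorThree x y z 0 1 3 * w 2 + minorThree x y z 0 2 3 * w 1 -
    minorThree x y z 1 2 3 * w 0

theorem wedgeTwo_succ (v : ℕ → Fin 4 → R) (M : ℕ) (j k : Fin 4) :
    wedgeTwo v (M + 1) j k = wedgeTwo v M j k +
      ((∑ a ∈ Finset.range M, v a j) * v M k - (∑ a ∈ Finset.range M, v a k) * v M j) := by
  rw [wedgeTwo, Finset.sum_range_succ, Finset.sum_sub_distrib, ← Finset.sum_mul, ← Finset.sum_mul,
    wedgeTwo]

/-- The odd companion of `sum_detFour`: a Pfaffian bordered by the column sums. It evaluates the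
increment in `sum_detFour` once the determinants are expanded along their last row. -/
theorem sum_minorThree (v : ℕ → Fin 4 → R) (M : ℕ) (j k l : Fin 4) :
    ∑ c ∈ Finset.range M, ∑ b ∈ Finset.range c, ∑ a ∈ Finset.range b,
        minorThree (v a) (v b) (v c) j k l =
      wedgeTwo v M j k * (∑ a ∈ Finset.range M, v a l) -
        wedgeTwo v M j l * (∑ a ∈ Finset.range M, v a k) +
        wedgeTwo v M k l * (∑ a ∈ Finset.range M, v a j) := by
  induction M with
  | zero => simp [wedgeTwo]
  | succ M ih =>
    have h : ∑ b ∈ Finset.range M, ∑ a ∈ Finset.range b, minorThree (v a) (v b) (v M) j k l =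
        wedgeTwo v M j k * v M l - wedgeTwo v M j l * v M k + wedgeTwo v M k l * v M j := by
      simp only [minorThree, wedgeTwo, Finset.sum_add_distrib,
        Finset.sum_sub_distrib (f := fun x => _ * v M _), ← Finset.sum_mul]
    rw [Finset.sum_range_succ, ih, h]
    simp only [wedgeTwo_succ, Finset.sum_range_succ]
    ring

/-- The sum of all maximal minors of a matrix with four columns is a Pfaffian. -/
theorem sum_detFour (v : ℕ → Fin 4 → R) (M : ℕ) :
    ∑ d ∈ Finset.range M, ∑ c ∈ Finset.range d, ∑ b ∈ Finset.range c, ∑ a ∈ Finset.range b,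
        detFour (v a) (v b) (v c) (v d) =
      wedgeTwo v M 0 1 * wedgeTwo v M 2 3 - wedgeTwo v M 0 2 * wedgeTwo v M 1 3 +
        wedgeTwo v M 0 3 * wedgeTwo v M 1 2 := by
  induction M with
  | zero => simp [wedgeTwo]
  | succ M ih =>
    have h : ∑ c ∈ Finset.range M, ∑ b ∈ Finset.range c, ∑ a ∈ Finset.range b,
        detFour (v a) (v b) (v c) (v M) =
        (∑ c ∈ Finset.range M, ∑ b ∈ Finset.range c, ∑ a ∈ Finset.range b,
          minorThree (v a) (v b) (v c) 0 1 2) * v M 3 -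
        (∑ c ∈ Finset.range M, ∑ b ∈ Finset.range c, ∑ a ∈ Finset.range b,
          minorThree (v a) (v b) (v c) 0 1 3) * v M 2 +
        (∑ c ∈ Finset.range M, ∑ b ∈ Finset.range c, ∑ a ∈ Finset.range b,
          minorThree (v a) (v b) (v c) 0 2 3) * v M 1 -
        (∑ c ∈ Finset.range M, ∑ b ∈ Finset.range c, ∑ a ∈ Finset.range b,
          minorThree (v a) (v b) (v c) 1 2 3) * v M 0 := by
      simp only [detFour, Finset.sum_add_distrib, Finset.sum_sub_distrib, ← Finset.sum_mul]
    rw [Finset.sum_range_succ, ih, h]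
    simp only [sum_minorThree, wedgeTwo_succ]
    ring

/-- Sums over pairs of integers in `[0, K]` of `h_x h_y` with `x - y = e`. -/
def diagSum (h : ℤ → R) (K : ℕ) (e : ℤ) : R :=
  ∑ x ∈ Finset.range (K + 1), ∑ y ∈ Finset.range (K + 1),
    if (x : ℤ) - y = e then h x * h y else 0

theorem diagSum_neg (h : ℤ → R) (K : ℕ) (e : ℤ) : diagSum h K (-e) = diagSum h K e := by
  rw [diagSum, Finset.sum_comm, diagSum]
  refine Finset.sum_congr rfl fun x _ => Finset.sum_congr rfl fun y _ => ?_
  rw [mul_comm (h x)]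
  exact if_congr (by omega) rfl rfl

/-- The support of `f` lies in `[0, K]`, and a shift by at most `3` keeps it inside the range of
length `K + 4`. -/
theorem sum_range_shift (f : ℤ → R) (K s : ℕ) (hs : s ≤ 3)
    (hf : ∀ x, x < 0 ∨ (K : ℤ) < x → f x = 0) :
    ∑ a ∈ Finset.range (K + 4), f (a - s) = ∑ x ∈ Finset.range (K + 1), f x := by
  have e : K + 4 = s + ((K + 1) + (3 - s)) := by omega
  rw [e, Finset.sum_range_add, Finset.sum_range_add, Finset.sum_eq_zero, zero_add]
  · rw [Finset.sum_eq_zero (s := Finset.range (3 - s)), add_zero]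
    · refine Finset.sum_congr rfl fun x _ => ?_
      congr 1
      push_cast
      ring
    · intro x _
      exact hf _ (Or.inr (by push_cast; omega))
  · intro x hx
    have := Finset.mem_range.mp hx
    exact hf _ (Or.inl (by omega))

theorem sum_range_lt (g : ℕ → ℕ → R) (M : ℕ) :
    ∑ b ∈ Finset.range M, ∑ a ∈ Finset.range b, g a b =
      ∑ a ∈ Finset.range M, ∑ b ∈ Finset.range M, if a < b then g a b else 0 := by
  rw [Finset.sum_comm]
  refine Finset.sum_congr rfl fun b hb => ?_
  rw [← Finset.sum_filter]
  refine Finset.sum_congr ?_ fun _ _ => rfl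
  ext a
  have := Finset.mem_range.mp hb
  simp only [Finset.mem_range, Finset.mem_filter]
  omega

theorem sum_range_shift_two (h : ℤ → R) (K s t : ℕ) (hs : s ≤ 3) (ht : t ≤ 3)
    (hh : ∀ x, x < 0 ∨ (K : ℤ) < x → h x = 0) :
    ∑ b ∈ Finset.range (K + 4), ∑ a ∈ Finset.range b, h (a - s) * h (b - t) =
      ∑ x ∈ Finset.range (K + 1), ∑ y ∈ Finset.range (K + 1),
        if (x : ℤ) + s < y + t then h x * h y else 0 := by
  rw [sum_range_lt (fun a b : ℕ => h (a - s) * h (b - t))]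
  have h1 : ∀ a : ℕ, ∑ b ∈ Finset.range (K + 4), (if a < b then h (a - s) * h (b - t) else 0) =
      (fun x : ℤ => ∑ y ∈ Finset.range (K + 1),
        if x + s < y + t then h x * h y else 0) ((a : ℤ) - s) := by
    intro a
    simp only
    rw [← sum_range_shift (fun y : ℤ => if (a : ℤ) - s + s < y + t then h (a - s) * h y else 0)
      K t ht]
    · refine Finset.sum_congr rfl fun b _ => if_congr (by omega) rfl rfl
    · intro x hx
      simp [hh x hx]
  rw [Finset.sum_congr rfl fun a _ => h1 a]
  refine sum_range_shift (fun x : ℤ => ∑ y ∈ Finset.range (K + 1),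
        if x + s < y + t then h x * h y else 0) K s hs ?_
  intro x hx
  simp [hh x hx]

/-- Sums over pairs of integers in `[0, K]` of `h_x h_y` with `-e ≤ x - y < e`. -/
def bandSum (h : ℤ → R) (K : ℕ) (e : ℤ) : R :=
  ∑ x ∈ Finset.range (K + 1), ∑ y ∈ Finset.range (K + 1),
    if -e ≤ (x : ℤ) - y ∧ (x : ℤ) - y < e then h x * h y else 0

/-- Widening the band adds the diagonals `x - y = e` and `x - y = -(e + 1)`; the latter is reflected
by the symmetry of `diagSum`. -/
theorem bandSum_succ (h : ℤ → R) (K : ℕ) (e : ℤ) (he : 0 ≤ e) :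
    bandSum h K (e + 1) = bandSum h K e + diagSum h K (e + 1) + diagSum h K e := by
  rw [← diagSum_neg h K (e + 1)]
  simp only [bandSum, diagSum, ← Finset.sum_add_distrib]
  refine Finset.sum_congr rfl fun x _ => Finset.sum_congr rfl fun y _ => ?_
  by_cases h1 : (x : ℤ) - y = -(e + 1)
  · rw [if_pos (by omega), if_neg (by omega), if_pos h1, if_neg (by omega)]; ring
  · by_cases h2 : (x : ℤ) - y = e
    · rw [if_pos (by omega), if_neg (by omega), if_neg h1, if_pos h2]; ring
    · rw [if_neg h1, if_neg h2, add_zero, add_zero]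
      exact if_congr (by omega) rfl rfl

theorem bandSum_zero (h : ℤ → R) (K : ℕ) : bandSum h K 0 = 0 := by
  refine Finset.sum_eq_zero fun x _ => Finset.sum_eq_zero fun y _ => if_neg (by omega)

/-- After shifting indices, with `e = k - j`, the two products in the minors run over `x - y < -e`
and `x - y < e`. Their difference is minus the band, so the minor sums depend only on `k - j`. -/
theorem wedgeTwo_eq_bandSum (h : ℤ → R) (K : ℕ) (hh : ∀ x, x < 0 ∨ (K : ℤ) < x → h x = 0)
    (j k : Fin 4) (hjk : j ≤ k) :
    wedgeTwo (fun a j => h (a - (3 - j : ℕ))) (K + 4) j k = -bandSum h K (k - j) := by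
  simp only [wedgeTwo, Finset.sum_sub_distrib]
  rw [sum_range_shift_two h K _ _ (by omega) (by omega) hh,
    sum_range_shift_two h K _ _ (by omega) (by omega) hh]
  simp only [bandSum, ← Finset.sum_sub_distrib, ← Finset.sum_neg_distrib]
  refine Finset.sum_congr rfl fun x _ => Finset.sum_congr rfl fun y _ => ?_
  have hjk' : (j : ℕ) ≤ k := hjk
  have := j.2
  have := k.2
  split_ifs <;> first | omega | ring

/-- The sum of the maximal minors of the matrix with rows `(h_{a-3}, h_{a-2}, h_{a-1}, h_a)`. -/
theorem sum_detFour_hankel (h : ℤ → R) (K : ℕ) (hh : ∀ x, x < 0 ∨ (K : ℤ) < x → h x = 0) :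
    ∑ d ∈ Finset.range (K + 4), ∑ c ∈ Finset.range d, ∑ b ∈ Finset.range c, ∑ a ∈ Finset.range b,
        detFour (fun j => h (a - (3 - j : ℕ))) (fun j => h (b - (3 - j : ℕ)))
          (fun j => h (c - (3 - j : ℕ))) (fun j => h (d - (3 - j : ℕ))) =
      (diagSum h K 0 + diagSum h K 1) * (diagSum h K 0 + diagSum h K 3) -
        (diagSum h K 1 + diagSum h K 2) ^ 2 := by
  have hs := sum_detFour (fun a (j : Fin 4) => h ((a : ℤ) - (3 - j : ℕ))) (K + 4)
  -- In terms of the band sums `B_e` the Pfaffian is `B₁² - B₂² + B₃ B₁`; the recursion rewrites it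
  -- in diagonal sums.
  have b1 := bandSum_succ h K 0 le_rfl
  have b2 := bandSum_succ h K 1 (by norm_num)
  have b3 := bandSum_succ h K 2 (by norm_num)
  norm_num at b1 b2 b3
  rw [bandSum_zero, zero_add] at b1
  rw [hs, wedgeTwo_eq_bandSum h K hh 0 1 (by decide), wedgeTwo_eq_bandSum h K hh 2 3 (by decide),
    wedgeTwo_eq_bandSum h K hh 0 2 (by decide), wedgeTwo_eq_bandSum h K hh 1 3 (by decide),
    wedgeTwo_eq_bandSum h K hh 0 3 (by decide), wedgeTwo_eq_bandSum h K hh 1 2 (by decide)]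
  norm_num
  rw [b3, b2, b1]
  ring

end Pfaffian

/-! ### The Pfaffian formula in the ring of symmetric functions -/

/-- The terms `h_r t ^ r` of the generating series, truncated at degree `K`. -/
noncomputable def hTrunc (K : ℕ) (r : ℤ) : Polynomial SymFun :=
  if r ≤ K then Polynomial.C (hz r) * Polynomial.X ^ r.toNat else 0

theorem hTrunc_of_neg_or_gt (K : ℕ) (r : ℤ) (h : r < 0 ∨ (K : ℤ) < r) : hTrunc K r = 0 := by
  rw [hTrunc]
  split_ifs with h'
  · rw [hz_of_neg (by omega), map_zero, zero_mul]
  · rfl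

/-- The truncation is invisible in degree `N ≤ K`: with nonnegative indices, one index above `K`
already forces the total degree above `N`. -/
theorem coeff_prod_hTrunc {N K : ℕ} (hNK : N ≤ K) {k : ℕ} (r : Fin k → ℤ) :
    (∏ i, hTrunc K (r i)).coeff N = if ∑ i, r i = N then ∏ i, hz (r i) else 0 := by
  by_cases hneg : ∃ i, r i < 0
  · obtain ⟨i, hi⟩ := hneg
    rw [Finset.prod_eq_zero (Finset.mem_univ i) (hTrunc_of_neg_or_gt K _ (Or.inl hi)),
      Finset.prod_eq_zero (Finset.mem_univ i) (hz_of_neg hi)]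
    simp
  · push Not at hneg
    by_cases hgt : ∃ i, (K : ℤ) < r i
    · obtain ⟨i, hi⟩ := hgt
      have := Finset.single_le_sum (f := r) (fun j _ => hneg j) (Finset.mem_univ i)
      rw [Finset.prod_eq_zero (Finset.mem_univ i) (hTrunc_of_neg_or_gt K _ (Or.inr hi)),
        if_neg (by omega)]
      simp
    · push Not at hgt
      have h1 : ∀ i, hTrunc K (r i) = Polynomial.C (hz (r i)) * Polynomial.X ^ (r i).toNat :=
        fun i => if_pos (hgt i)
      have h2 : ((∑ i, (r i).toNat : ℕ) : ℤ) = ∑ i, r i := by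
        rw [Nat.cast_sum]
        exact Finset.sum_congr rfl fun i _ => Int.toNat_of_nonneg (hneg i)
      simp only [h1]
      rw [Finset.prod_mul_distrib, ← map_prod, Finset.prod_pow_eq_pow_sum, Polynomial.coeff_C_mul,
        Polynomial.coeff_X_pow, ← h2, mul_ite, mul_one, mul_zero]
      exact if_congr (by rw [eq_comm, Nat.cast_inj]) rfl rfl

theorem coeff_mul_hTrunc {N K : ℕ} (hNK : N ≤ K) (x y z w : ℤ) :
    (hTrunc K x * hTrunc K y * hTrunc K z * hTrunc K w).coeff N =
      if x + y + z + w = N then hz x * hz y * hz z * hz w else 0 := by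
  have := coeff_prod_hTrunc hNK ![x, y, z, w]
  simpa [Fin.prod_univ_four, Fin.sum_univ_four] using this

theorem detFour_eq_det {R : Type*} [CommRing R] (x y z w : Fin 4 → R) :
    detFour x y z w = Matrix.det (Matrix.of ![x, y, z, w]) := by
  rw [Matrix.det_succ_row_zero]
  simp [Fin.sum_univ_succ, Matrix.det_succ_row_zero, detFour, minorThree, Fin.succAbove]
  ring

/-- All terms of the determinant have the same degree `∑ a_i - (3 + 2 + 1 + 0)`, which accounts for
the `6`. -/
theorem coeff_det_hTrunc {N K : ℕ} (hNK : N ≤ K) (a : Fin 4 → ℤ) :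
    (Matrix.det (Matrix.of fun i j : Fin 4 => hTrunc K (a i - (3 - j : ℕ)))).coeff N =
      if ∑ i, a i = N + 6 then Matrix.det (Matrix.of fun i j : Fin 4 => hz (a i - (3 - j : ℕ)))
      else 0 := by
  rw [Matrix.det_apply, Polynomial.finsetSum_coeff, Matrix.det_apply]
  have h : ∀ σ : Equiv.Perm (Fin 4), (Equiv.Perm.sign σ •
      ∏ i, (Matrix.of fun i j : Fin 4 => hTrunc K (a i - (3 - j : ℕ))) (σ i) i).coeff N =
      if ∑ i, a i = N + 6 then Equiv.Perm.sign σ •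
        ∏ i, (Matrix.of fun i j : Fin 4 => hz (a i - (3 - j : ℕ))) (σ i) i else 0 := by
    intro σ
    simp only [Matrix.of_apply]
    have hs : ∑ i : Fin 4, (a (σ i) - (3 - i : ℕ)) = ∑ i, a i - 6 := by
      rw [Finset.sum_sub_distrib, Equiv.sum_comp σ a]
      rfl
    rw [Units.smul_def, Units.smul_def, Polynomial.coeff_smul,
      coeff_prod_hTrunc hNK (fun i : Fin 4 => a (σ i) - (3 - i : ℕ)), hs]
    by_cases hc : ∑ i, a i = N + 6
    · rw [if_pos (by omega), if_pos hc]
    · rw [if_neg (by omega), if_neg hc, smul_zero]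
  rw [Finset.sum_congr rfl fun σ _ => h σ]
  split_ifs <;> simp

/-- The rows are listed in reverse, in the order used by `sum_detFour`; reversing four rows is an
even permutation. -/
theorem jt_four (p q r s : ℤ) : jt ![p, q, r, s] =
    detFour (fun j => hz (s - 3 + j)) (fun j => hz (r - 2 + j)) (fun j => hz (q - 1 + j))
      (fun j => hz (p + j)) := by
  rw [jt, Matrix.det_succ_row_zero]
  simp [Fin.sum_univ_succ, Matrix.det_succ_row_zero, detFour, minorThree, Fin.succAbove]
  ring

/-- Strictly increasing `a < b < c < d` encode the partition `(d - 3, c - 2, b - 1, a)`, so the sum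
runs over all four-row Jacobi–Trudi determinants of degree `N`. -/
theorem sum_jt_four {N K : ℕ} (hNK : N ≤ K) :
    ∑ d ∈ Finset.range (K + 4), ∑ c ∈ Finset.range d, ∑ b ∈ Finset.range c, ∑ a ∈ Finset.range b,
        (if a + b + c + d = N + 6 then jt ![(d : ℤ) - 3, (c : ℤ) - 2, (b : ℤ) - 1, a] else 0) =
      ((diagSum (hTrunc K) K 0 + diagSum (hTrunc K) K 1) *
        (diagSum (hTrunc K) K 0 + diagSum (hTrunc K) K 3) -
        (diagSum (hTrunc K) K 1 + diagSum (hTrunc K) K 2) ^ 2).coeff N := by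
  rw [← sum_detFour_hankel _ K (hTrunc_of_neg_or_gt K)]
  simp only [Polynomial.finsetSum_coeff]
  refine Finset.sum_congr rfl fun d _ => Finset.sum_congr rfl fun c _ =>
    Finset.sum_congr rfl fun b _ => Finset.sum_congr rfl fun a _ => ?_
  have h1 := coeff_det_hTrunc hNK ![(a : ℤ), b, c, d]
  have h2 : (Matrix.of fun i j : Fin 4 =>
      hTrunc K ((![(a : ℤ), b, c, d] : Fin 4 → ℤ) i - (3 - j : ℕ))) =
      Matrix.of ![fun j : Fin 4 => hTrunc K (a - (3 - j : ℕ)),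
        fun j : Fin 4 => hTrunc K (b - (3 - j : ℕ)), fun j : Fin 4 => hTrunc K (c - (3 - j : ℕ)),
        fun j : Fin 4 => hTrunc K (d - (3 - j : ℕ))] := by
    ext1 i j
    fin_cases i <;> rfl
  have h3 : (Matrix.of fun i j : Fin 4 =>
      hz ((![(a : ℤ), b, c, d] : Fin 4 → ℤ) i - (3 - j : ℕ))) =
      Matrix.of ![fun j : Fin 4 => hz (a - (3 - j : ℕ)),
        fun j : Fin 4 => hz (b - (3 - j : ℕ)), fun j : Fin 4 => hz (c - (3 - j : ℕ)),
        fun j : Fin 4 => hz (d - (3 - j : ℕ))] := by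
    ext1 i j
    fin_cases i <;> rfl
  have hj : ∀ j : Fin 4, ((3 - (j : ℕ) : ℕ) : ℤ) = 3 - (j : ℤ) := fun j => by omega
  rw [h2, h3, ← detFour_eq_det, ← detFour_eq_det] at h1
  rw [h1, jt_four]
  simp only [Fin.sum_univ_four, Matrix.cons_val, hj]
  have e1 : ((a : ℤ) + b + c + d = N + 6) ↔ a + b + c + d = N + 6 := by omega
  simp only [e1]
  congr 3 <;> funext j <;> congr 1 <;> ring

/-- Sums of `h_x h_y h_z h_w` over quadruples in `[0, K]` with a given property. -/
noncomputable def boxSum (K : ℕ) (P : ℤ → ℤ → ℤ → ℤ → Prop) [∀ x y z w, Decidable (P x y z w)] :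
    SymFun :=
  ∑ x ∈ Finset.range (K + 1), ∑ y ∈ Finset.range (K + 1), ∑ z ∈ Finset.range (K + 1),
    ∑ w ∈ Finset.range (K + 1), if P x y z w then hn x * hn y * hn z * hn w else 0

theorem boxSum_congr (K : ℕ) {P Q : ℤ → ℤ → ℤ → ℤ → Prop} [∀ x y z w, Decidable (P x y z w)]
    [∀ x y z w, Decidable (Q x y z w)] (h : ∀ x y z w, P x y z w ↔ Q x y z w) :
    boxSum K P = boxSum K Q :=
  Finset.sum_congr rfl fun x _ => Finset.sum_congr rfl fun y _ => Finset.sum_congr rfl fun z _ =>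
    Finset.sum_congr rfl fun w _ => if_congr (h x y z w) rfl rfl

theorem boxSum_eq_zero (K : ℕ) {P : ℤ → ℤ → ℤ → ℤ → Prop} [∀ x y z w, Decidable (P x y z w)]
    (h : ∀ x y z w, ¬ P x y z w) : boxSum K P = 0 :=
  Finset.sum_eq_zero fun x _ => Finset.sum_eq_zero fun y _ => Finset.sum_eq_zero fun z _ =>
    Finset.sum_eq_zero fun w _ => if_neg (h x y z w)

/-- The two factors are read as the diagonal `x, w` and the antidiagonal `y, z` of a `2 × 2` matrix,
for comparison with `kronecker_hn_mul_hn`, where the margins fix `x - w`, `y - z` and the total. -/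
theorem coeff_diagSum_mul_diagSum {N K : ℕ} (hNK : N ≤ K) (e f : ℤ) :
    (diagSum (hTrunc K) K e * diagSum (hTrunc K) K f).coeff N =
      boxSum K fun x y z w => x - w = e ∧ y - z = f ∧ x + y + z + w = N := by
  rw [diagSum, diagSum, Finset.sum_mul_sum]
  simp only [Finset.sum_mul_sum, Polynomial.finsetSum_coeff, boxSum]
  refine Finset.sum_congr rfl fun x _ => Finset.sum_congr rfl fun y _ => ?_
  rw [Finset.sum_comm]
  refine Finset.sum_congr rfl fun z _ => Finset.sum_congr rfl fun w _ => ?_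
  by_cases h1 : (x : ℤ) - w = e
  · by_cases h2 : (y : ℤ) - z = f
    · have hp : hTrunc K x * hTrunc K w * (hTrunc K y * hTrunc K z) =
          hTrunc K x * hTrunc K y * hTrunc K z * hTrunc K w := by ring
      rw [if_pos h1, if_pos h2, hp, coeff_mul_hTrunc hNK]
      simp only [h1, h2, true_and, hz_natCast]
    · rw [if_neg h2, mul_zero, if_neg (fun h => h2 h.2.1), Polynomial.coeff_zero]
  · rw [if_neg h1, zero_mul, if_neg (fun h => h1 h.1), Polynomial.coeff_zero]

theorem sum_antidiagonal_eq_sum_range {R : Type*} [AddCommMonoid R] {c K : ℕ} (hc : c ≤ K)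
    (f : ℕ → ℕ → R) : ∑ p ∈ antidiagonal c, f p.1 p.2 =
      ∑ x ∈ Finset.range (K + 1), ∑ y ∈ Finset.range (K + 1), if x + y = c then f x y else 0 := by
  rw [← Finset.sum_product' (f := fun x y => if x + y = c then f x y else 0), ← Finset.sum_filter]
  refine Finset.sum_congr ?_ fun _ _ => rfl
  ext ⟨x, y⟩
  simp only [Finset.HasAntidiagonal.mem_antidiagonal, Finset.mem_filter, Finset.mem_product,
    Finset.mem_range]
  omega

/-- The Kronecker product of `h_c h_d` and `h_a h_b` is a sum over nonnegative integer matrices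
with row sums `c, d` and column sums `a, b`. -/
theorem kronecker_hn_mul_hn {c d K : ℕ} (hc : c ≤ K) (hd : d ≤ K) (a b : ℤ) :
    kronecker (hn c * hn d) (hz a * hz b) =
      boxSum K fun x y z w => x + y = c ∧ z + w = d ∧ x + z = a ∧ y + w = b := by
  rw [kronecker_hz_mul_hz, map_mul, scaleTwo_hn, scaleTwo_hn,
    sum_antidiagonal_eq_sum_range hc (fun i j => Polynomial.C (Polynomial.C (hn i * hn j) *
      Polynomial.X ^ i) * Polynomial.X ^ j),
    sum_antidiagonal_eq_sum_range hd (fun i j => Polynomial.C (Polynomial.C (hn i * hn j) *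
      Polynomial.X ^ i) * Polynomial.X ^ j)]
  by_cases hab : 0 ≤ a ∧ 0 ≤ b
  · rw [if_pos hab]
    obtain ⟨ha, hb⟩ := hab
    lift a to ℕ using ha
    lift b to ℕ using hb
    simp only [Finset.sum_mul]
    simp only [Finset.mul_sum, Polynomial.finsetSum_coeff, boxSum,
      Int.toNat_natCast]
    refine Finset.sum_congr rfl fun x _ => Finset.sum_congr rfl fun y _ =>
      Finset.sum_congr rfl fun z _ => Finset.sum_congr rfl fun w _ => ?_
    by_cases h1 : x + y = c
    · by_cases h2 : z + w = d
      · have hp : (Polynomial.C (Polynomial.C (hn x * hn y) * Polynomial.X ^ x) *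
            Polynomial.X ^ y) * (Polynomial.C (Polynomial.C (hn z * hn w) * Polynomial.X ^ z) *
            Polynomial.X ^ w) = Polynomial.C (Polynomial.C (hn x * hn y * hn z * hn w) *
            Polynomial.X ^ (x + z)) * Polynomial.X ^ (y + w) := by
          simp only [map_mul, map_pow]
          ring
        rw [if_pos h1, if_pos h2, hp, Polynomial.coeff_C_mul_X_pow]
        by_cases h3 : b = y + w
        · rw [if_pos h3, Polynomial.coeff_C_mul_X_pow]
          exact if_congr (by omega) rfl rfl
        · rw [if_neg h3, Polynomial.coeff_zero, if_neg (by omega)]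
      · rw [if_neg h2, mul_zero, if_neg (by omega), Polynomial.coeff_zero, Polynomial.coeff_zero]
    · rw [if_neg h1, zero_mul, if_neg (by omega), Polynomial.coeff_zero, Polynomial.coeff_zero]
  · rw [if_neg hab]
    symm
    refine Finset.sum_eq_zero fun x _ => Finset.sum_eq_zero fun y _ =>
      Finset.sum_eq_zero fun z _ => Finset.sum_eq_zero fun w _ => if_neg (by omega)

theorem jt_two (p q : ℤ) : jt ![p, q] = hz p * hz q - hz (p + 1) * hz (q - 1) := by
  rw [jt, Matrix.det_fin_two]
  simp

/-! ### Sums over partitions with at most four parts -/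

/-- Partitions of `N` with at most four parts, as weakly decreasing quadruples. -/
def quadruples (N : ℕ) : Finset (ℕ × ℕ × ℕ × ℕ) :=
  (Finset.range (N + 1) ×ˢ Finset.range (N + 1) ×ˢ Finset.range (N + 1) ×ˢ
    Finset.range (N + 1)).filter fun t =>
      t.2.1 ≤ t.1 ∧ t.2.2.1 ≤ t.2.1 ∧ t.2.2.2 ≤ t.2.2.1 ∧ t.1 + t.2.1 + t.2.2.1 + t.2.2.2 = N

theorem mem_quadruples {N a b c d : ℕ} : (a, b, c, d) ∈ quadruples N ↔
    b ≤ a ∧ c ≤ b ∧ d ≤ c ∧ a + b + c + d = N := by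
  simp only [quadruples, Finset.mem_filter, Finset.mem_product, Finset.mem_range]
  omega

/-- The Jacobi–Trudi determinant of a quadruple. -/
noncomputable def jtQuad (t : ℕ × ℕ × ℕ × ℕ) : SymFun :=
  jt ![(t.1 : ℤ), (t.2.1 : ℤ), (t.2.2.1 : ℤ), (t.2.2.2 : ℤ)]

theorem sum_jtQuad {N K : ℕ} (hNK : N ≤ K) :
    ∑ t ∈ quadruples N, jtQuad t =
      ∑ d ∈ Finset.range (K + 4), ∑ c ∈ Finset.range d, ∑ b ∈ Finset.range c, ∑ a ∈ Finset.range b,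
        (if a + b + c + d = N + 6 then jt ![(d : ℤ) - 3, (c : ℤ) - 2, (b : ℤ) - 1, a] else 0) := by
  rw [Finset.sum_sigma', Finset.sum_sigma', Finset.sum_sigma', ← Finset.sum_filter]
  refine Finset.sum_bij' (fun t _ => ⟨⟨⟨t.1 + 3, t.2.1 + 2⟩, t.2.2.1 + 1⟩, t.2.2.2⟩)
    (fun s _ => (s.1.1.1 - 3, s.1.1.2 - 2, s.1.2 - 1, s.2)) ?_ ?_ ?_ ?_ ?_
  · rintro ⟨a, b, c, d⟩ h
    rw [mem_quadruples] at h
    simp only [Finset.mem_filter, Finset.mem_sigma, Finset.mem_range]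
    omega
  · rintro ⟨⟨⟨d, c⟩, b⟩, a⟩ h
    simp only [Finset.mem_filter, Finset.mem_sigma, Finset.mem_range] at h ⊢
    rw [mem_quadruples]
    omega
  · rintro ⟨a, b, c, d⟩ _
    simp
  · rintro ⟨⟨⟨d, c⟩, b⟩, a⟩ h
    simp only [Finset.mem_filter, Finset.mem_sigma, Finset.mem_range] at h
    have h1 : d - 3 + 3 = d := by omega
    have h2 : c - 2 + 2 = c := by omega
    have h3 : b - 1 + 1 = b := by omega
    simp only [h1, h2, h3]
  · rintro ⟨a, b, c, d⟩ _
    simp [jtQuad]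

/-- Expanding both determinants gives matrix sums with `(x - w, y - z)` equal to `(1, 0)`, `(2, 1)`,
`(2, -1)`, `(3, 0)`. These are the Pfaffian terms that survive, since `(x - w) + (y - z)` must be
odd like the total. -/
theorem kronecker_odd (m : ℕ) (hm : 1 ≤ m) :
    kronecker (jt ![(m : ℤ) + 1, (m : ℤ)]) (jt ![(m : ℤ) + 1, (m : ℤ)]) =
      ∑ t ∈ quadruples (2 * m + 1), jtQuad t := by
  have hNK : 2 * m + 1 ≤ 2 * m + 3 := by omega
  rw [sum_jtQuad hNK, sum_jt_four hNK]
  set K := 2 * m + 3 with hK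
  have hl : jt ![(m : ℤ) + 1, (m : ℤ)] = hn (m + 1) * hn m - hn (m + 2) * hn (m - 1) := by
    rw [jt_two, ← hz_natCast, ← hz_natCast, ← hz_natCast, ← hz_natCast]
    push_cast [Nat.cast_sub hm]
    ring_nf
  have hr : jt ![(m : ℤ) + 1, (m : ℤ)] = hz (m + 1) * hz m - hz (m + 2) * hz (m - 1) := by
    rw [jt_two]
    ring_nf
  -- The term `2 D₁ D₂` of the square is written as `D₂ D₋₁ + D₂ D₁`, one summand for each of the
  -- two mixed Kronecker products.
  have h1 : (diagSum (hTrunc K) K 0 + diagSum (hTrunc K) K 1) *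
        (diagSum (hTrunc K) K 0 + diagSum (hTrunc K) K 3) -
        (diagSum (hTrunc K) K 1 + diagSum (hTrunc K) K 2) ^ 2 =
      diagSum (hTrunc K) K 1 * diagSum (hTrunc K) K 0 +
      diagSum (hTrunc K) K 3 * diagSum (hTrunc K) K 0 -
      diagSum (hTrunc K) K 2 * diagSum (hTrunc K) K (-1) -
      diagSum (hTrunc K) K 2 * diagSum (hTrunc K) K 1 +
      diagSum (hTrunc K) K 0 * diagSum (hTrunc K) K 0 +
      diagSum (hTrunc K) K 1 * diagSum (hTrunc K) K 3 -
      diagSum (hTrunc K) K 1 * diagSum (hTrunc K) K 1 -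
      diagSum (hTrunc K) K 2 * diagSum (hTrunc K) K 2 := by
    rw [diagSum_neg]
    ring
  rw [h1]
  simp only [Polynomial.coeff_sub, Polynomial.coeff_add, coeff_diagSum_mul_diagSum hNK]
  rw [boxSum_eq_zero K (P := fun x y z w => x - w = 0 ∧ y - z = 0 ∧ _) (by omega),
    boxSum_eq_zero K (P := fun x y z w => x - w = 1 ∧ y - z = 3 ∧ _) (by omega),
    boxSum_eq_zero K (P := fun x y z w => x - w = 1 ∧ y - z = 1 ∧ _) (by omega),
    boxSum_eq_zero K (P := fun x y z w => x - w = 2 ∧ y - z = 2 ∧ _) (by omega)]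
  rw [hr]
  nth_rewrite 1 [← hr]
  rw [hl]
  simp only [map_sub, LinearMap.sub_apply]
  have k0 : kronecker (hn (m + 1) * hn m) (hz (m + 1) * hz m) =
      boxSum K (fun x y z w => x - w = 1 ∧ y - z = 0 ∧ x + y + z + w = ((2 * m + 1 : ℕ) : ℤ)) :=
    (kronecker_hn_mul_hn (by omega) (by omega) _ _).trans
      (boxSum_congr K fun x y z w => by push_cast [Nat.cast_sub hm]; omega)
  have k1 : kronecker (hn (m + 2) * hn (m - 1)) (hz (m + 1) * hz m) =
      boxSum K (fun x y z w => x - w = 2 ∧ y - z = 1 ∧ x + y + z + w = ((2 * m + 1 : ℕ) : ℤ)) :=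
    (kronecker_hn_mul_hn (by omega) (by omega) _ _).trans
      (boxSum_congr K fun x y z w => by push_cast [Nat.cast_sub hm]; omega)
  have k2 : kronecker (hn (m + 1) * hn m) (hz (m + 2) * hz (m - 1)) =
      boxSum K (fun x y z w => x - w = 2 ∧ y - z = -1 ∧ x + y + z + w = ((2 * m + 1 : ℕ) : ℤ)) :=
    (kronecker_hn_mul_hn (by omega) (by omega) _ _).trans
      (boxSum_congr K fun x y z w => by push_cast [Nat.cast_sub hm]; omega)
  have k3 : kronecker (hn (m + 2) * hn (m - 1)) (hz (m + 2) * hz (m - 1)) =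
      boxSum K (fun x y z w => x - w = 3 ∧ y - z = 0 ∧ x + y + z + w = ((2 * m + 1 : ℕ) : ℤ)) :=
    (kronecker_hn_mul_hn (by omega) (by omega) _ _).trans
      (boxSum_congr K fun x y z w => by push_cast [Nat.cast_sub hm]; omega)
  rw [k0, k1, k2, k3]
  ring

/-- The second argument is `s_{(m,m)} + s_{(m+1,m-1)}`. In even degree the surviving pairs `(x - w,
y - z)` are `(0, 0)`, `(1, 1)`, `(2, -2)`, `(3, -1)`, up to the symmetry of `diagSum`. -/
theorem kronecker_even (m : ℕ) (hm : 1 ≤ m) :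
    kronecker (jt ![(m : ℤ), (m : ℤ)]) (hz m * hz m - hz (m + 2) * hz (m - 2)) =
      ∑ t ∈ quadruples (2 * m), jtQuad t := by
  have hNK : 2 * m ≤ 2 * m + 3 := by omega
  rw [sum_jtQuad hNK, sum_jt_four hNK]
  set K := 2 * m + 3 with hK
  have hl : jt ![(m : ℤ), (m : ℤ)] = hn m * hn m - hn (m + 1) * hn (m - 1) := by
    rw [jt_two, ← hz_natCast, ← hz_natCast, ← hz_natCast]
    push_cast [Nat.cast_sub hm]
    ring_nf
  have h1 : (diagSum (hTrunc K) K 0 + diagSum (hTrunc K) K 1) *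
        (diagSum (hTrunc K) K 0 + diagSum (hTrunc K) K 3) -
        (diagSum (hTrunc K) K 1 + diagSum (hTrunc K) K 2) ^ 2 =
      diagSum (hTrunc K) K 0 * diagSum (hTrunc K) K 0 +
      diagSum (hTrunc K) K 3 * diagSum (hTrunc K) K (-1) -
      diagSum (hTrunc K) K 1 * diagSum (hTrunc K) K 1 -
      diagSum (hTrunc K) K 2 * diagSum (hTrunc K) K (-2) +
      diagSum (hTrunc K) K 1 * diagSum (hTrunc K) K 0 +
      diagSum (hTrunc K) K 0 * diagSum (hTrunc K) K 3 -
      diagSum (hTrunc K) K 1 * diagSum (hTrunc K) K 2 -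
      diagSum (hTrunc K) K 2 * diagSum (hTrunc K) K 1 := by
    rw [diagSum_neg, diagSum_neg]
    ring
  rw [h1]
  simp only [Polynomial.coeff_sub, Polynomial.coeff_add, coeff_diagSum_mul_diagSum hNK]
  rw [boxSum_eq_zero K (P := fun x y z w => x - w = 1 ∧ y - z = 0 ∧ _) (by omega),
    boxSum_eq_zero K (P := fun x y z w => x - w = 0 ∧ y - z = 3 ∧ _) (by omega),
    boxSum_eq_zero K (P := fun x y z w => x - w = 1 ∧ y - z = 2 ∧ _) (by omega),
    boxSum_eq_zero K (P := fun x y z w => x - w = 2 ∧ y - z = 1 ∧ _) (by omega)]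
  rw [hl]
  simp only [map_sub, LinearMap.sub_apply]
  have k0 : kronecker (hn m * hn m) (hz m * hz m) =
      boxSum K (fun x y z w => x - w = 0 ∧ y - z = 0 ∧ x + y + z + w = ((2 * m : ℕ) : ℤ)) :=
    (kronecker_hn_mul_hn (by omega) (by omega) _ _).trans
      (boxSum_congr K fun x y z w => by push_cast [Nat.cast_sub hm]; omega)
  have k1 : kronecker (hn (m + 1) * hn (m - 1)) (hz m * hz m) =
      boxSum K (fun x y z w => x - w = 1 ∧ y - z = 1 ∧ x + y + z + w = ((2 * m : ℕ) : ℤ)) :=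
    (kronecker_hn_mul_hn (by omega) (by omega) _ _).trans
      (boxSum_congr K fun x y z w => by push_cast [Nat.cast_sub hm]; omega)
  have k2 : kronecker (hn m * hn m) (hz (m + 2) * hz (m - 2)) =
      boxSum K (fun x y z w => x - w = 2 ∧ y - z = -2 ∧ x + y + z + w = ((2 * m : ℕ) : ℤ)) :=
    (kronecker_hn_mul_hn (by omega) (by omega) _ _).trans
      (boxSum_congr K fun x y z w => by push_cast [Nat.cast_sub hm]; omega)
  have k3 : kronecker (hn (m + 1) * hn (m - 1)) (hz (m + 2) * hz (m - 2)) =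
      boxSum K (fun x y z w => x - w = 3 ∧ y - z = -1 ∧ x + y + z + w = ((2 * m : ℕ) : ℤ)) :=
    (kronecker_hn_mul_hn (by omega) (by omega) _ _).trans
      (boxSum_congr K fun x y z w => by push_cast [Nat.cast_sub hm]; omega)
  rw [k0, k1, k2, k3]
  ring

/-! ### Multiplication by `p₁` -/

theorem hz_one : hz 1 = pw 0 := hn_one

theorem jt_three_one (p q : ℤ) :
    pw 0 * jt ![p, q] = jt ![p, q, 1] + jt ![p + 1, q] + jt ![p, q + 1] := by
  have h : jt ![p, q, 1] = hz p * (hz q * hz 1 - hz (q + 1) * hz 0) -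
      hz (p + 1) * (hz (q - 1) * hz 1) + hz (p + 2) * hz (q - 1) := by
    rw [jt, Matrix.det_fin_three]
    simp only [Matrix.of_apply, Matrix.cons_val, Fin.val_zero, Fin.val_one, Fin.val_two]
    push_cast
    rw [hz_of_neg (by norm_num : (-1 : ℤ) < 0)]
    ring_nf
    simp only [hz_zero]
    ring
  rw [h, jt_two, jt_two, jt_two, hz_zero, hz_one]
  ring_nf

/-- A fifth part equal to `1` has Jacobi–Trudi row `(h₋₃, h₋₂, h₋₁, h₀, h₁) = (0, 0, 0, 1, h₁)`, so
only two minors remain. -/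
theorem det_five_last {R : Type*} [CommRing R] (x y z w : Fin 5 → R) (t : R) :
    Matrix.det (Matrix.of ![x, y, z, w, ![0, 0, 0, 1, t]]) =
      t * detFour ![w 0, w 1, w 2, w 3] ![z 0, z 1, z 2, z 3] ![y 0, y 1, y 2, y 3]
        ![x 0, x 1, x 2, x 3] -
      detFour ![w 0, w 1, w 2, w 4] ![z 0, z 1, z 2, z 4] ![y 0, y 1, y 2, y 4]
        ![x 0, x 1, x 2, x 4] := by
  simp [Fin.sum_univ_succ, Matrix.det_succ_row_zero, detFour, minorThree, Fin.succAbove]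
  ring

/-- Raising each row index in turn equals raising each column index in turn; raising any column but
the last produces a repeated column, leaving the minor on columns `0, 1, 2, 4`. -/
theorem detFour_shift {R : Type*} [CommRing R] (x y z w : Fin 5 → R) :
    detFour ![w 1, w 2, w 3, w 4] ![z 0, z 1, z 2, z 3] ![y 0, y 1, y 2, y 3]
        ![x 0, x 1, x 2, x 3] +
      detFour ![w 0, w 1, w 2, w 3] ![z 1, z 2, z 3, z 4] ![y 0, y 1, y 2, y 3]
        ![x 0, x 1, x 2, x 3] +
      detFour ![w 0, w 1, w 2, w 3] ![z 0, z 1, z 2, z 3] ![y 1, y 2, y 3, y 4]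
        ![x 0, x 1, x 2, x 3] +
      detFour ![w 0, w 1, w 2, w 3] ![z 0, z 1, z 2, z 3] ![y 0, y 1, y 2, y 3]
        ![x 1, x 2, x 3, x 4] =
      detFour ![w 0, w 1, w 2, w 4] ![z 0, z 1, z 2, z 4] ![y 0, y 1, y 2, y 4]
        ![x 0, x 1, x 2, x 4] := by
  simp only [detFour, minorThree, Matrix.cons_val]
  ring

/-- Pieri's rule for multiplication by `p₁`. -/
theorem pw_zero_mul_jt_four (p q r s : ℤ) :
    pw 0 * jt ![p, q, r, s] = jt ![p + 1, q, r, s] + jt ![p, q + 1, r, s] + jt ![p, q, r + 1, s] +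
      jt ![p, q, r, s + 1] + jt ![p, q, r, s, 1] := by
  have h5 : jt ![p, q, r, s, 1] = Matrix.det (Matrix.of ![fun j : Fin 5 => hz (p + j),
      fun j : Fin 5 => hz (q - 1 + j), fun j : Fin 5 => hz (r - 2 + j),
      fun j : Fin 5 => hz (s - 3 + j), ![0, 0, 0, 1, hz 1]]) := by
    rw [jt]
    congr 2
    funext i j
    fin_cases i
    · simp
    · simp
    · simp
    · simp
    · have h3 : hz (-3) = 0 := rfl
      have h2 : hz (-2) = 0 := rfl
      have h1 : hz (-1) = 0 := rfl
      fin_cases j <;> simp [h1, h2, h3]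
  have h4 := fun x y z w : ℤ => jt_four x y z w
  have hs := detFour_shift (fun j : Fin 5 => hz (p + j)) (fun j : Fin 5 => hz (q - 1 + j))
    (fun j : Fin 5 => hz (r - 2 + j)) (fun j : Fin 5 => hz (s - 3 + j))
  have hv : ∀ a : ℤ, (fun j : Fin 4 => hz (a + j)) = ![hz a, hz (a + 1), hz (a + 2), hz (a + 3)] :=
    fun a => by
      funext j
      fin_cases j <;> simp
  rw [h5, det_five_last, ← hs, h4, h4, h4, h4, h4, hz_one]
  simp only [hv]
  simp only [Fin.val_zero, Fin.val_one, Fin.val_two, Nat.cast_zero, Nat.cast_one, Nat.cast_ofNat,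
    add_zero, show ((3 : Fin 5) : ℕ) = 3 from rfl, show ((4 : Fin 5) : ℕ) = 4 from rfl]
  ring_nf

/-! ### Pieri's rule summed over quadruples -/

/-- Two consecutive rows coincide. Thus the terms of Pieri's rule that are not partitions vanish. -/
theorem jt_four_eq_zero (p q r s : ℤ) (h : q = p + 1 ∨ r = q + 1 ∨ s = r + 1) :
    jt ![p, q, r, s] = 0 := by
  rw [jt_four]
  rcases h with rfl | rfl | rfl
  · have e : (fun j : Fin 4 => hz (p + 1 - 1 + j)) = fun j : Fin 4 => hz (p + j) := by
      funext j; congr 1; ring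
    rw [e, detFour]
    simp only [minorThree]
    ring
  · have e : (fun j : Fin 4 => hz (q + 1 - 2 + j)) = fun j : Fin 4 => hz (q - 1 + j) := by
      funext j; congr 1; ring
    rw [e, detFour]
    simp only [minorThree]
    ring
  · have e : (fun j : Fin 4 => hz (r + 1 - 3 + j)) = fun j : Fin 4 => hz (r - 2 + j) := by
      funext j; congr 1; ring
    rw [e, detFour]
    simp only [minorThree]
    ring

theorem jt_five_eq_zero (p q r : ℤ) : jt ![p, q, r, 0, 1] = 0 := by
  rw [jt]
  refine Matrix.det_zero_of_row_eq (i := 3) (j := 4) (by decide) ?_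
  funext j
  simp

/-- The number of distinct positive entries of a quadruple. -/
def jumps (t : ℕ × ℕ × ℕ × ℕ) : ℕ :=
  (if t.2.1 < t.1 then 1 else 0) + (if t.2.2.1 < t.2.1 then 1 else 0) +
    (if t.2.2.2 < t.2.2.1 then 1 else 0) + (if 0 < t.2.2.2 then 1 else 0)

/-- Here `e` adds a box to a fixed row, `e'` removes it, and `P` says that the removal leaves a
partition. Images under `e` that are not partitions need no attention because their determinants
vanish. -/
theorem sum_quadruples_shift (N : ℕ) (e : ℕ × ℕ × ℕ × ℕ → ℕ × ℕ × ℕ × ℕ)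
    (e' : ℕ × ℕ × ℕ × ℕ → ℕ × ℕ × ℕ × ℕ) (P : ℕ × ℕ × ℕ × ℕ → Prop) [DecidablePred P]
    (h1 : ∀ t ∈ quadruples N, jtQuad (e t) ≠ 0 → e t ∈ quadruples (N + 1) ∧ P (e t))
    (h2 : ∀ t ∈ quadruples (N + 1), P t → e' t ∈ quadruples N ∧ e (e' t) = t)
    (h3 : ∀ t, e' (e t) = t) :
    ∑ t ∈ quadruples N, jtQuad (e t) =
      ∑ t ∈ quadruples (N + 1), (if P t then 1 else 0 : ℕ) • jtQuad t := by
  simp only [ite_smul, one_smul, zero_smul]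
  rw [← Finset.sum_filter]
  refine Finset.sum_bij_ne_zero (fun t _ _ => e t) ?_ ?_ ?_ ?_
  · intro t ht hne
    exact Finset.mem_filter.mpr (h1 t ht hne)
  · intro t _ _ t' _ _ h
    rw [← h3 t, h, h3]
  · intro t ht hne
    have ht' := Finset.mem_filter.mp ht
    obtain ⟨h4, h5⟩ := h2 t ht'.1 ht'.2
    exact ⟨e' t, h4, by rwa [h5], h5⟩
  · intro t _ _
    rfl

theorem sum_jtQuad_first (N : ℕ) :
    ∑ t ∈ quadruples N, jtQuad (t.1 + 1, t.2.1, t.2.2.1, t.2.2.2) =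
      ∑ t ∈ quadruples (N + 1), (if t.2.1 < t.1 then 1 else 0 : ℕ) • jtQuad t := by
  refine sum_quadruples_shift N (fun t => (t.1 + 1, t.2.1, t.2.2.1, t.2.2.2))
    (fun t => (t.1 - 1, t.2.1, t.2.2.1, t.2.2.2)) _ ?_ ?_ ?_
  · rintro ⟨a, b, c, d⟩ h _
    rw [mem_quadruples] at h
    simp only
    rw [mem_quadruples]
    omega
  · rintro ⟨a, b, c, d⟩ h h'
    simp only at h'
    rw [mem_quadruples] at h
    simp only [mem_quadruples, Prod.mk.injEq, and_true]
    omega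
  · rintro ⟨a, b, c, d⟩
    simp

theorem sum_jtQuad_second (N : ℕ) :
    ∑ t ∈ quadruples N, jtQuad (t.1, t.2.1 + 1, t.2.2.1, t.2.2.2) =
      ∑ t ∈ quadruples (N + 1), (if t.2.2.1 < t.2.1 then 1 else 0 : ℕ) • jtQuad t := by
  refine sum_quadruples_shift N (fun t => (t.1, t.2.1 + 1, t.2.2.1, t.2.2.2))
    (fun t => (t.1, t.2.1 - 1, t.2.2.1, t.2.2.2)) _ ?_ ?_ ?_
  · rintro ⟨a, b, c, d⟩ h hne
    have : b ≠ a := by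
      rintro rfl
      exact hne (jt_four_eq_zero _ _ _ _ (Or.inl (by simp)))
    rw [mem_quadruples] at h
    simp only
    rw [mem_quadruples]
    omega
  · rintro ⟨a, b, c, d⟩ h h'
    simp only at h'
    rw [mem_quadruples] at h
    simp only [mem_quadruples, Prod.mk.injEq, and_true, true_and]
    omega
  · rintro ⟨a, b, c, d⟩
    simp

theorem sum_jtQuad_third (N : ℕ) :
    ∑ t ∈ quadruples N, jtQuad (t.1, t.2.1, t.2.2.1 + 1, t.2.2.2) =
      ∑ t ∈ quadruples (N + 1), (if t.2.2.2 < t.2.2.1 then 1 else 0 : ℕ) • jtQuad t := by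
  refine sum_quadruples_shift N (fun t => (t.1, t.2.1, t.2.2.1 + 1, t.2.2.2))
    (fun t => (t.1, t.2.1, t.2.2.1 - 1, t.2.2.2)) _ ?_ ?_ ?_
  · rintro ⟨a, b, c, d⟩ h hne
    have : c ≠ b := by
      rintro rfl
      exact hne (jt_four_eq_zero _ _ _ _ (Or.inr (Or.inl (by simp))))
    rw [mem_quadruples] at h
    simp only
    rw [mem_quadruples]
    omega
  · rintro ⟨a, b, c, d⟩ h h'
    simp only at h'
    rw [mem_quadruples] at h
    simp only [mem_quadruples, Prod.mk.injEq, and_true, true_and]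
    omega
  · rintro ⟨a, b, c, d⟩
    simp

theorem sum_jtQuad_fourth (N : ℕ) :
    ∑ t ∈ quadruples N, jtQuad (t.1, t.2.1, t.2.2.1, t.2.2.2 + 1) =
      ∑ t ∈ quadruples (N + 1), (if 0 < t.2.2.2 then 1 else 0 : ℕ) • jtQuad t := by
  refine sum_quadruples_shift N (fun t => (t.1, t.2.1, t.2.2.1, t.2.2.2 + 1))
    (fun t => (t.1, t.2.1, t.2.2.1, t.2.2.2 - 1)) _ ?_ ?_ ?_
  · rintro ⟨a, b, c, d⟩ h hne
    have : d ≠ c := by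
      rintro rfl
      exact hne (jt_four_eq_zero _ _ _ _ (Or.inr (Or.inr (by simp))))
    rw [mem_quadruples] at h
    simp only
    rw [mem_quadruples]
    omega
  · rintro ⟨a, b, c, d⟩ h h'
    simp only at h'
    rw [mem_quadruples] at h
    simp only [mem_quadruples, Prod.mk.injEq, true_and]
    omega
  · rintro ⟨a, b, c, d⟩
    simp

theorem jtQuad_mk (a b c d : ℕ) : jtQuad (a, b, c, d) = jt ![(a : ℤ), (b : ℤ), (c : ℤ), (d : ℤ)] :=
  rfl

/-- A quadruple of size `N + 1` arises once for every removable corner, and these are counted by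
`jumps`. A box opening a fifth row needs a positive fourth part. -/
theorem pw_zero_mul_sum_jtQuad (N : ℕ) :
    pw 0 * ∑ t ∈ quadruples N, jtQuad t =
      ∑ t ∈ quadruples (N + 1), jumps t • jtQuad t +
      ∑ t ∈ quadruples N with 0 < t.2.2.2,
        jt ![(t.1 : ℤ), (t.2.1 : ℤ), (t.2.2.1 : ℤ), (t.2.2.2 : ℤ), 1] := by
  have hp : ∀ t : ℕ × ℕ × ℕ × ℕ, pw 0 * jtQuad t =
      jtQuad (t.1 + 1, t.2.1, t.2.2.1, t.2.2.2) + jtQuad (t.1, t.2.1 + 1, t.2.2.1, t.2.2.2) +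
      jtQuad (t.1, t.2.1, t.2.2.1 + 1, t.2.2.2) + jtQuad (t.1, t.2.1, t.2.2.1, t.2.2.2 + 1) +
      jt ![(t.1 : ℤ), (t.2.1 : ℤ), (t.2.2.1 : ℤ), (t.2.2.2 : ℤ), 1] := by
    rintro ⟨a, b, c, d⟩
    simp only [jtQuad_mk, Nat.cast_add, Nat.cast_one, pw_zero_mul_jt_four]
  have h5 : ∑ t ∈ quadruples N with 0 < t.2.2.2,
        jt ![(t.1 : ℤ), (t.2.1 : ℤ), (t.2.2.1 : ℤ), (t.2.2.2 : ℤ), 1] = ∑ t ∈ quadruples N,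
        jt ![(t.1 : ℤ), (t.2.1 : ℤ), (t.2.2.1 : ℤ), (t.2.2.2 : ℤ), 1] := by
    refine Finset.sum_filter_of_ne ?_
    rintro ⟨a, b, c, d⟩ _ hne
    refine Nat.pos_of_ne_zero ?_
    rintro rfl
    exact hne (jt_five_eq_zero _ _ _)
  rw [Finset.mul_sum, Finset.sum_congr rfl fun t _ => hp t, h5]
  simp only [Finset.sum_add_distrib, jumps, add_smul, sum_jtQuad_first, sum_jtQuad_second,
    sum_jtQuad_third, sum_jtQuad_fourth]

/-- The Kronecker product `s_{(m,m,1)} * s_{(m+1,m)}` as a sum of Jacobi–Trudi determinants. -/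
theorem kronecker_jt (m : ℕ) (hm : 1 ≤ m) :
    kronecker (jt ![(m : ℤ), (m : ℤ), 1]) (jt ![(m : ℤ) + 1, (m : ℤ)]) =
      ∑ t ∈ quadruples (2 * m + 1), ((jumps t : ℚ) - 1) • jtQuad t +
      ∑ t ∈ quadruples (2 * m) with 0 < t.2.2.2,
        jt ![(t.1 : ℤ), (t.2.1 : ℤ), (t.2.2.1 : ℤ), (t.2.2.2 : ℤ), 1] := by
  have h0 : jt ![(m : ℤ), (m : ℤ) + 1] = 0 := by
    rw [jt_two]
    ring_nf
  have h1 : jt ![(m : ℤ), (m : ℤ), 1] =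
      pw 0 * jt ![(m : ℤ), (m : ℤ)] - jt ![(m : ℤ) + 1, (m : ℤ)] := by
    rw [jt_three_one, h0]
    ring
  -- The two terms `h_{m+1} h_{m-1}` from the Leibniz rule cancel.
  have h2 : (((0 : ℕ) : SymFun) + 1) * pderiv (Nat.succPNat 0) (jt ![(m : ℤ) + 1, (m : ℤ)]) =
      hz m * hz m - hz (m + 2) * hz (m - 2) := by
    have hd := fun r => pderiv_hz 0 r
    simp only [Nat.cast_zero, zero_add, one_mul] at hd
    rw [jt_two, map_sub, Derivation.leibniz, Derivation.leibniz]
    simp only [smul_eq_mul, hd, Nat.cast_zero, zero_add, one_mul]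
    ring_nf
  rw [h1, map_sub, LinearMap.sub_apply, kronecker_pw_mul, h2, kronecker_even m hm,
    kronecker_odd m hm, pw_zero_mul_sum_jtQuad]
  simp only [sub_smul, one_smul, Finset.sum_sub_distrib, Nat.cast_smul_eq_nsmul]
  ring

/-! ### Partitions as tuples -/

/-- In a weakly decreasing list the zeros form a tail, and the default value `0` replaces them after
filtering. -/
theorem getD_filter_pos (L : List ℕ) (hL : L.Pairwise (· ≥ ·)) (i : ℕ) :
    (L.filter (0 < ·)).getD i 0 = L.getD i 0 := by
  induction L generalizing i with
  | nil => rfl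
  | cons x xs ih =>
    obtain ⟨h1, h2⟩ := List.pairwise_cons.mp hL
    by_cases hx : 0 < x
    · rw [List.filter_cons_of_pos (by simpa using hx)]
      cases i with
      | zero => rfl
      | succ i => simpa using ih h2 i
    · have hx0 : x = 0 := by omega
      have hxs : ∀ y ∈ xs, y = 0 := fun y hy => by
        have := h1 y hy
        omega
      rw [List.filter_cons_of_neg (by simpa using hx),
        List.filter_eq_nil_iff.mpr (fun y hy => by simpa using hxs y hy)]
      rw [List.getD_nil]
      by_cases hi : i < (x :: xs).length
      · rw [List.getD_eq_getElem _ _ hi]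
        have := List.getElem_mem hi
        rcases List.mem_cons.mp this with h | h
        · rw [h, hx0]
        · exact (hxs _ h).symm
      · rw [List.getD_eq_default _ _ (not_lt.mp hi)]

theorem exists_partition {N : ℕ} (L : List ℕ) (hL : L.Pairwise (· ≥ ·)) (hN : L.sum = N) :
    ∃ θ : N.Partition, ∀ i, part θ (i + 1) = L.getD i 0 := by
  refine ⟨Nat.Partition.ofSums N (L : Multiset ℕ) (by simpa using hN), fun i => ?_⟩
  rw [← getD_filter_pos L hL, part, Nat.add_sub_cancel]
  congr 1
  have hp : (L.filter (0 < ·)).Pairwise (· ≥ ·) := hL.filter _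
  rw [sortedParts]
  refine List.Perm.eq_of_pairwise (le := (· ≥ ·)) (fun a b _ _ h h' => le_antisymm h' h)
    (Multiset.pairwise_sort _ _) hp ?_
  rw [← Multiset.coe_eq_coe, Multiset.sort_eq]
  simp only [Nat.Partition.ofSums]
  rw [← Multiset.filter_coe]
  refine Multiset.filter_congr fun x _ => ?_
  simp [Nat.pos_iff_ne_zero]

theorem part_pos_iff {N : ℕ} (p : N.Partition) (k : ℕ) : 0 < part p (k + 1) ↔ k < length p := by
  constructor
  · intro h
    by_contra! h'
    rw [part_eq_zero p h'] at h
    exact lt_irrefl _ h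
  · intro h
    rw [← length_sortedParts] at h
    rw [part, Nat.add_sub_cancel, List.getD_eq_getElem _ _ h]
    exact part_pos p (List.getElem_mem h)

theorem mem_parts_iff {N : ℕ} (p : N.Partition) (x : ℕ) :
    x ∈ p.parts ↔ 0 < x ∧ ∃ i, part p (i + 1) = x := by
  have h : x ∈ p.parts ↔ x ∈ sortedParts p := by simp [sortedParts]
  rw [h]
  constructor
  · intro hx
    obtain ⟨i, hi, rfl⟩ := List.getElem_of_mem hx
    refine ⟨part_pos p hx, i, ?_⟩
    rw [part, Nat.add_sub_cancel, List.getD_eq_getElem _ _ hi]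
  · rintro ⟨h0, i, rfl⟩
    rw [part_pos_iff, ← length_sortedParts] at h0
    rw [part, Nat.add_sub_cancel, List.getD_eq_getElem _ _ h0]
    exact List.getElem_mem h0

/-- The first four parts of a partition. -/
def toQuad {N : ℕ} (p : N.Partition) : ℕ × ℕ × ℕ × ℕ :=
  (part p 1, part p 2, part p 3, part p 4)

theorem sum_part {N : ℕ} (p : N.Partition) (k : ℕ) (hk : length p ≤ k) :
    ∑ i ∈ Finset.range k, part p (i + 1) = N := by
  have h1 : (sortedParts p).sum = N := by
    rw [← Multiset.sum_coe, sortedParts, Multiset.sort_eq, p.parts_sum]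
  have h2 : ∑ i ∈ Finset.range (length p), part p (i + 1) = (sortedParts p).sum := by
    rw [← length_sortedParts, Finset.sum_range, ← Fin.sum_univ_getElem]
    refine Finset.sum_congr rfl fun i _ => ?_
    rw [part, Nat.add_sub_cancel, List.getD_eq_getElem _ _ i.2]
  rw [← Finset.sum_subset (Finset.range_mono hk), h2, h1]
  intro i _ hi
  exact part_eq_zero p (by simpa using hi)

theorem card_insert_erase_zero {S : Finset ℕ} {a b : ℕ} (hb : b ∈ S) (hS : ∀ x ∈ S, x ≤ b)
    (hab : b ≤ a) :
    ((insert a S).erase 0).card = (if b < a then 1 else 0) + (S.erase 0).card := by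
  split_ifs with h
  · have ha : a ∉ S := fun h' => absurd (hS a h') (by omega)
    rw [Finset.erase_insert_of_ne (by omega), Finset.card_insert_of_notMem, add_comm]
    exact fun h' => ha (Finset.mem_of_mem_erase h')
  · have : a = b := by omega
    rw [this, Finset.insert_eq_self.mpr hb, zero_add]

theorem numDistinctParts_eq_jumps {N : ℕ} (p : N.Partition) (h : length p ≤ 4) :
    numDistinctParts p = jumps (toQuad p) := by
  have h12 : part p 2 ≤ part p 1 := part_antitone p (i := 0) (j := 1) (by omega)
  have h23 : part p 3 ≤ part p 2 := part_antitone p (i := 1) (j := 2) (by omega)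
  have h34 : part p 4 ≤ part p 3 := part_antitone p (i := 2) (j := 3) (by omega)
  have hset : p.parts.toFinset = (insert (part p 1) (insert (part p 2)
      (insert (part p 3) ({part p 4} : Finset ℕ)))).erase 0 := by
    ext x
    rw [Multiset.mem_toFinset, mem_parts_iff, Finset.mem_erase, Nat.pos_iff_ne_zero]
    refine and_congr_right fun hx => ?_
    simp only [Finset.mem_insert, Finset.mem_singleton]
    constructor
    · rintro ⟨i, rfl⟩
      rw [← Nat.pos_iff_ne_zero, part_pos_iff] at hx
      have hi : i < 4 := hx.trans_le h
      interval_cases i <;> simp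
    · rintro (rfl | rfl | rfl | rfl)
      exacts [⟨0, rfl⟩, ⟨1, rfl⟩, ⟨2, rfl⟩, ⟨3, rfl⟩]
  have hlast : (({part p 4} : Finset ℕ).erase 0).card = if 0 < part p 4 then 1 else 0 := by
    split_ifs with h0
    · rw [Finset.erase_eq_of_notMem (by simp; omega), Finset.card_singleton]
    · rw [show part p 4 = 0 by omega]
      rfl
  rw [numDistinctParts, hset, card_insert_erase_zero (b := part p 2) (by simp) _ h12,
    card_insert_erase_zero (b := part p 3) (by simp) _ h23,
    card_insert_erase_zero (b := part p 4) (by simp) _ h34, hlast]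
  · change _ = (if part p 2 < part p 1 then 1 else 0) + (if part p 3 < part p 2 then 1 else 0) +
      (if part p 4 < part p 3 then 1 else 0) + (if 0 < part p 4 then 1 else 0)
    ring
  · simp
  · simp [h34]
  · simp [h23, h34.trans h23]

theorem schur_eq_jtQuad {N : ℕ} (p : N.Partition) (h : length p ≤ 4) :
    schur p = realize (jtQuad (toQuad p)) := by
  have e : (fun i : Fin 4 => (part p (i + 1) : ℤ)) =
      ![(part p 1 : ℤ), (part p 2 : ℤ), (part p 3 : ℤ), (part p 4 : ℤ)] := by
    funext i
    fin_cases i <;> rfl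
  rw [schur_eq_realize_jt p 4 h, e, toQuad, jtQuad_mk]

theorem schur_eq_jt_five {N : ℕ} (p : N.Partition) (h : length p ≤ 5) :
    schur p = realize (jt ![(part p 1 : ℤ), (part p 2 : ℤ), (part p 3 : ℤ), (part p 4 : ℤ),
      (part p 5 : ℤ)]) := by
  have e : (fun i : Fin 5 => (part p (i + 1) : ℤ)) =
      ![(part p 1 : ℤ), (part p 2 : ℤ), (part p 3 : ℤ), (part p 4 : ℤ), (part p 5 : ℤ)] := by
    funext i
    fin_cases i <;> rfl
  rw [schur_eq_realize_jt p 5 h, e]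

theorem sum_length_le_four (N : ℕ) :
    ∑ θ : N.Partition with length θ ≤ 4, ((numDistinctParts θ : ℚ) - 1) • schur θ =
      realize (∑ t ∈ quadruples N, ((jumps t : ℚ) - 1) • jtQuad t) := by
  rw [map_sum]
  refine Finset.sum_bij (fun θ _ => toQuad θ) ?_ ?_ ?_ ?_
  · intro θ hθ
    have h := (Finset.mem_filter.mp hθ).2
    have hs := sum_part θ 4 h
    simp only [Finset.sum_range_succ, Finset.sum_range_zero, zero_add] at hs
    exact mem_quadruples.mpr ⟨part_antitone θ (i := 0) (j := 1) (by omega),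
      part_antitone θ (i := 1) (j := 2) (by omega),
      part_antitone θ (i := 2) (j := 3) (by omega), hs⟩
  · intro θ hθ θ' hθ' h
    have h1 := (Finset.mem_filter.mp hθ).2
    have h2 := (Finset.mem_filter.mp hθ').2
    simp only [toQuad, Prod.mk.injEq] at h
    refine eq_of_part_eq fun i => ?_
    rcases lt_or_ge i 4 with hi | hi
    · interval_cases i
      exacts [h.1, h.2.1, h.2.2.1, h.2.2.2]
    · rw [part_eq_zero θ (h1.trans hi), part_eq_zero θ' (h2.trans hi)]
  · rintro ⟨a, b, c, d⟩ h
    rw [mem_quadruples] at h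
    obtain ⟨θ, hθ⟩ := exists_partition (N := N) [a, b, c, d] (by simp; omega) (by simp; omega)
    refine ⟨θ, ?_, ?_⟩
    · rw [Finset.mem_filter]
      refine ⟨Finset.mem_univ _, ?_⟩
      by_contra! h'
      rw [← part_pos_iff, hθ] at h'
      simp at h'
    · simp only [toQuad]
      rw [show part θ 1 = a from hθ 0, show part θ 2 = b from hθ 1, show part θ 3 = c from hθ 2,
        show part θ 4 = d from hθ 3]
  · intro θ hθ
    have h := (Finset.mem_filter.mp hθ).2
    rw [map_smul, numDistinctParts_eq_jumps θ h, schur_eq_jtQuad θ h]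

theorem sum_length_eq_five (N : ℕ) :
    ∑ θ : (N + 1).Partition with length θ = 5 ∧ part θ 5 = 1, schur θ =
      realize (∑ t ∈ quadruples N with 0 < t.2.2.2,
        jt ![(t.1 : ℤ), (t.2.1 : ℤ), (t.2.2.1 : ℤ), (t.2.2.2 : ℤ), 1]) := by
  rw [map_sum]
  refine Finset.sum_bij (fun θ _ => toQuad θ) ?_ ?_ ?_ ?_
  · intro θ hθ
    obtain ⟨h5, h1⟩ := (Finset.mem_filter.mp hθ).2
    have hs := sum_part θ 5 h5.le
    simp only [Finset.sum_range_succ, Finset.sum_range_zero, zero_add, Nat.reduceAdd] at hs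
    rw [h1] at hs
    rw [Finset.mem_filter]
    exact ⟨mem_quadruples.mpr ⟨part_antitone θ (i := 0) (j := 1) (by omega),
      part_antitone θ (i := 1) (j := 2) (by omega),
      part_antitone θ (i := 2) (j := 3) (by omega), by omega⟩,
      (part_pos_iff θ 3).mpr (by omega)⟩
  · intro θ hθ θ' hθ' h
    have h1 := (Finset.mem_filter.mp hθ).2
    have h2 := (Finset.mem_filter.mp hθ').2
    simp only [toQuad, Prod.mk.injEq] at h
    refine eq_of_part_eq fun i => ?_
    rcases lt_or_ge i 5 with hi | hi
    · interval_cases i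
      exacts [h.1, h.2.1, h.2.2.1, h.2.2.2, h1.2.trans h2.2.symm]
    · rw [part_eq_zero θ (h1.1.trans_le hi), part_eq_zero θ' (h2.1.trans_le hi)]
  · rintro ⟨a, b, c, d⟩ h
    rw [Finset.mem_filter, mem_quadruples] at h
    simp only at h
    obtain ⟨θ, hθ⟩ := exists_partition (N := N + 1) [a, b, c, d, 1] (by simp; omega)
      (by simp; omega)
    refine ⟨θ, ?_, ?_⟩
    · rw [Finset.mem_filter]
      refine ⟨Finset.mem_univ _, le_antisymm ?_ ?_, hθ 4⟩
      · by_contra! h'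
        rw [← part_pos_iff, hθ] at h'
        simp at h'
      · refine (part_pos_iff θ 4).mp ?_
        rw [hθ]
        simp
    · simp only [toQuad]
      rw [show part θ 1 = a from hθ 0, show part θ 2 = b from hθ 1, show part θ 3 = c from hθ 2,
        show part θ 4 = d from hθ 3]
  · intro θ hθ
    obtain ⟨h5, h1⟩ := (Finset.mem_filter.mp hθ).2
    rw [schur_eq_jt_five θ h5.le, h1]
    rfl

/-- The multiplicity of `s_θ` in `s_{(n-1,n-1,1)} * s_{(n,n-1)}`. -/
def kroneckerCoeff {N : ℕ} (θ : N.Partition) : ℚ :=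
  if length θ = 5 ∧ part θ 5 = 1 then 1
  else if length θ ≤ 4 then (numDistinctParts θ : ℚ) - 1 else 0

theorem sum_kroneckerCoeff (N : ℕ) :
    ∑ θ : (N + 1).Partition, kroneckerCoeff θ • schur θ =
      realize (∑ t ∈ quadruples (N + 1), ((jumps t : ℚ) - 1) • jtQuad t +
        ∑ t ∈ quadruples N with 0 < t.2.2.2,
          jt ![(t.1 : ℤ), (t.2.1 : ℤ), (t.2.2.1 : ℤ), (t.2.2.2 : ℤ), 1]) := by
  rw [map_add, ← sum_length_le_four, ← sum_length_eq_five, Finset.sum_filter, Finset.sum_filter,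
    ← Finset.sum_add_distrib]
  refine Finset.sum_congr rfl fun θ _ => ?_
  rw [kroneckerCoeff]
  by_cases h1 : length θ = 5 ∧ part θ 5 = 1
  · rw [if_pos h1, if_pos h1, if_neg (by omega), one_smul, zero_add]
  · rw [if_neg h1, if_neg h1, add_zero]
    split_ifs <;> simp

/-! ### The two given shapes and the final expansion -/

theorem part_of_parts {N : ℕ} (p : N.Partition) (L : List ℕ) (hL : L.Pairwise (· ≥ ·))
    (h : p.parts = (L : Multiset ℕ)) (i : ℕ) : part p (i + 1) = L.getD i 0 := by
  rw [part, Nat.add_sub_cancel]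
  congr 1
  rw [sortedParts]
  refine List.Perm.eq_of_pairwise (le := (· ≥ ·)) (fun a b _ _ h h' => le_antisymm h' h)
    (Multiset.pairwise_sort _ _) hL ?_
  rw [← Multiset.coe_eq_coe, Multiset.sort_eq, h]

theorem schur_shapeThree (m : ℕ) (hm : 2 ≤ m + 1) :
    schur (shapeThree (m + 1) hm) = realize (jt ![(m : ℤ), (m : ℤ), 1]) := by
  have hp := part_of_parts (shapeThree (m + 1) hm) [m, m, 1] (by simp; omega) rfl
  have e : (fun i : Fin 3 => (part (shapeThree (m + 1) hm) (i + 1) : ℤ)) =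
      ![(m : ℤ), (m : ℤ), 1] := by
    funext i
    rw [hp]
    fin_cases i <;> simp
  rw [schur_eq_realize_jt _ 3 (le_of_eq rfl), e]

theorem schur_shapeTwo (m : ℕ) (hm : 2 ≤ m + 1) :
    schur (shapeTwo (m + 1) hm) = realize (jt ![(m : ℤ) + 1, (m : ℤ)]) := by
  have hp := part_of_parts (shapeTwo (m + 1) hm) [m + 1, m] (by simp) rfl
  have e : (fun i : Fin 2 => (part (shapeTwo (m + 1) hm) (i + 1) : ℤ)) =
      ![(m : ℤ) + 1, (m : ℤ)] := by
    funext i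
    rw [hp]
    fin_cases i <;> simp
  rw [schur_eq_realize_jt _ 2 (le_of_eq rfl), e]

/-- By `realize_injective`, `F` and `G` must be the Jacobi–Trudi determinants, so `kronecker_jt`
applies to any choice of preimages. -/
theorem realize_kronecker_eq (m : ℕ) (hm : 2 ≤ m + 1) (F G : SymFun)
    (hF : realize F = schur (shapeThree (m + 1) hm))
    (hG : realize G = schur (shapeTwo (m + 1) hm)) :
    realize (kronecker F G) =
      ∑ θ : (2 * (m + 1) - 1).Partition, kroneckerCoeff θ • schur θ := by
  rw [schur_shapeThree] at hF
  rw [schur_shapeTwo] at hG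
  rw [realize_injective hF, realize_injective hG, kronecker_jt m (by omega)]
  exact (sum_kroneckerCoeff (2 * m)).symm

end KroneckerProduct

/-- The Kronecker coefficients of `(n - 1, n - 1, 1)` and `(n, n - 1)` exist, are unique, and are
given by the stated formula. -/
theorem mainTheorem2 (n : ℕ) (hn : 2 ≤ n) (g : (2 * n - 1).Partition → ℚ) :
    KroneckerProduct.IsKroneckerCoefficients
        (KroneckerProduct.shapeThree n hn) (KroneckerProduct.shapeTwo n hn) g ↔
      ∀ θ : (2 * n - 1).Partition,
        g θ =
          if KroneckerProduct.length θ = 5 ∧ KroneckerProduct.part θ 5 = 1 then 1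
          else if KroneckerProduct.length θ ≤ 4 then (KroneckerProduct.numDistinctParts θ : ℚ) - 1
          else 0 := by
  obtain ⟨m, rfl⟩ : ∃ m, n = m + 1 := ⟨n - 1, by omega⟩
  constructor
  · rintro ⟨F, G, hF, hG, h⟩ θ
    rw [KroneckerProduct.realize_kronecker_eq m hn F G hF hG] at h
    have hli := KroneckerProduct.linearIndependent_schur (2 * (m + 1) - 1)
    rw [Fintype.linearIndependent_iff] at hli
    have := hli (fun θ => g θ - KroneckerProduct.kroneckerCoeff θ)
      (by simp only [sub_smul, Finset.sum_sub_distrib, h, sub_self]) θ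
    exact sub_eq_zero.mp this
  · intro hg
    refine ⟨_, _, (KroneckerProduct.schur_shapeThree m hn).symm,
      (KroneckerProduct.schur_shapeTwo m hn).symm, ?_⟩
    rw [KroneckerProduct.realize_kronecker_eq m hn _ _
      (KroneckerProduct.schur_shapeThree m hn).symm (KroneckerProduct.schur_shapeTwo m hn).symm]
    refine Finset.sum_congr rfl fun θ _ => ?_
    rw [hg θ, KroneckerProduct.kroneckerCoeff]
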